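/- A labelled point set $(m,P,c)$ in $\mathbb{R}^d$ consists of an integer $m$, a finite set $P\subset\mathbb{R}^d$ and a labelling $c:P\to[m]$. It induces the nearest-neighbor classification $f:\mathbb{R}^d\to 2^{[m]}$, $f(q)=\{c(p) : p\in \mathrm{nn}(q,P)\}$, where $\mathrm{nn}(q,P)$ is the set of all points of $P$ at minimum Euclidean distance from $q$. A reduced training set of $(m,P,c)$ is a subset $Q\subseteq P$ such that $(m,Q,c|_Q)$ induces the same classification of $\mathbb{R}^d$ as $(m,P,c)$. The minimum cardinality reduced training set problem in dimension $d$ is to decide, given a labelled point set $(m,P,c)$ with rational coordinates (all numbers encoded in binary) and a natural number $k$, whether $(m,P,c)$ has a reduced training set of at most $k$ points. Theorem. The minimum cardinality reduced training set problem in dimension $1$ is in $\mathsf{P}$. Moreover, given a labelled point set in $\mathbb{R}^1$ with rational coordinates, a reduced training set of minimum cardinality can be computed in polynomial time. -/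

import Mathlib

/-- A labelled point set `(m, P, c)` in `ℝ^d`. -/
structure LabelledPointSet (d : ℕ) where
  /-- the number of labels -/
  m : ℕ
  /-- the (finite) set of points -/
  P : Finset (EuclideanSpace ℝ (Fin d))
  /-- the label of every point -/
  c : {p // p ∈ P} → Fin m

namespace LabelledPointSet

variable {d : ℕ}

/-- The set of nearest neighbors of `q` in `P`. -/
def nn (q : EuclideanSpace ℝ (Fin d)) (P : Finset (EuclideanSpace ℝ (Fin d))) :
    Set (EuclideanSpace ℝ (Fin d)) :=
  {p | p ∈ P ∧ ∀ p' ∈ P, dist q p ≤ dist q p'}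

/-- The nearest neighbor classification `f : ℝ^d → 2^[m]` induced by `(m, P, c)`,
`f q = {c p | p ∈ nn q P}`. -/
def classification (L : LabelledPointSet d) (q : EuclideanSpace ℝ (Fin d)) : Set (Fin L.m) :=
  {l | ∃ p : {p // p ∈ L.P}, p.1 ∈ nn q L.P ∧ L.c p = l}

/-- The labelled point set `(m, Q, c|_Q)` for `Q ⊆ P`. -/
def restrict (L : LabelledPointSet d) (Q : Finset (EuclideanSpace ℝ (Fin d))) (hQ : Q ⊆ L.P) :
    LabelledPointSet d where
  m := L.m
  P := Q
  c := fun p => L.c ⟨p.1, hQ p.2⟩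

/-- `Q` is a reduced training set of `(m, P, c)`: it is a subset of `P`, and `(m, Q, c|_Q)`
induces the same classification of `ℝ^d` as `(m, P, c)`. -/
def IsReducedTrainingSet (L : LabelledPointSet d) (Q : Finset (EuclideanSpace ℝ (Fin d))) : Prop :=
  ∃ hQ : Q ⊆ L.P, (L.restrict Q hQ).classification = L.classification

/-- `Q` is a reduced training set of minimum cardinality. -/
def IsMinimumReducedTrainingSet (L : LabelledPointSet d)
    (Q : Finset (EuclideanSpace ℝ (Fin d))) : Prop :=
  L.IsReducedTrainingSet Q ∧ ∀ Q', L.IsReducedTrainingSet Q' → Q.card ≤ Q'.card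

end LabelledPointSet

/-- The point of `ℝ^d` with the given rational coordinates. -/
noncomputable def ratPoint {d : ℕ} : (Fin d → ℚ) ↪ EuclideanSpace ℝ (Fin d) where
  toFun x := WithLp.toLp 2 (fun i => (x i : ℝ))
  inj' x y h := by
    funext i
    have := congrArg (fun v : EuclideanSpace ℝ (Fin d) => v i) h
    simpa using this

/-- A machine-readable labelled point set: the points have rational coordinates and are listed,
without repetition, in an arbitrary order; each carries a label in `[m]`. -/
structure RatLabelledPointSet (d : ℕ) where
  /-- the number of labels -/
  m : ℕ
  /-- the list of the points -/
  pts : List (Fin d → ℚ)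
  /-- every point is listed only once -/
  nodup : pts.Nodup
  /-- the label of every point -/
  c : {x // x ∈ pts} → Fin m

namespace RatLabelledPointSet

variable {d : ℕ}

/-- A list of rational points as a finite subset of `ℝ^d`. -/
noncomputable def pointSet (l : List (Fin d → ℚ)) : Finset (EuclideanSpace ℝ (Fin d)) :=
  l.toFinset.map ratPoint

theorem exists_of_mem_pointSet {l : List (Fin d → ℚ)} {p : EuclideanSpace ℝ (Fin d)}
    (hp : p ∈ pointSet l) : ∃ x : {x // x ∈ l}, ratPoint x.1 = p := by
  simp only [pointSet, Finset.mem_map, List.mem_toFinset] at hp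
  obtain ⟨x, hx, rfl⟩ := hp
  exact ⟨⟨x, hx⟩, rfl⟩

/-- The labelled point set in `ℝ^d` that a `RatLabelledPointSet` describes. -/
noncomputable def toLabelledPointSet (L : RatLabelledPointSet d) : LabelledPointSet d where
  m := L.m
  P := pointSet L.pts
  c := fun p => L.c (exists_of_mem_pointSet p.2).choose

/-- The point with rational coordinates `x` has the label that was prescribed for `x`. -/
theorem toLabelledPointSet_c (L : RatLabelledPointSet d) (x : {x // x ∈ L.pts})
    (hx : ratPoint x.1 ∈ L.toLabelledPointSet.P) :
    L.toLabelledPointSet.c ⟨ratPoint x.1, hx⟩ = L.c x := by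
  have h := (exists_of_mem_pointSet (l := L.pts) hx).choose_spec
  exact congrArg L.c (Subtype.ext (ratPoint.injective h))

end RatLabelledPointSet

/-- The alphabet of the encodings: binary digits, a minus sign, and separators. -/
inductive EncSym : Type
  | bit (b : Bool)
  | minus
  | slash
  | comma
  | colon
  | semicolon
  | bar
  deriving DecidableEq, Fintype

namespace EncSym

/-- Binary encoding of a natural number (least significant bit first; `0` is the empty word). -/
def encNat (n : ℕ) : List EncSym := (Computability.encodeNat n).map EncSym.bit

/-- Sign and magnitude encoding of an integer. -/
def encInt (z : ℤ) : List EncSym := (if z < 0 then [minus] else []) ++ encNat z.natAbs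

/-- Encoding of a rational number by numerator and denominator. -/
def encRat (q : ℚ) : List EncSym := encInt q.num ++ [slash] ++ encNat q.den

/-- Encoding of a point with rational coordinates. -/
def encPoint {d : ℕ} (x : Fin d → ℚ) : List EncSym :=
  (List.ofFn x).flatMap fun q => encRat q ++ [comma]

/-- Encoding of a list of points. -/
def encPoints {d : ℕ} (l : List (Fin d → ℚ)) : List EncSym :=
  l.flatMap fun x => encPoint x ++ [semicolon]

/-- Encoding of a labelled point set: the number of labels, then the points with their labels. -/
def encLabelledPointSet {d : ℕ} (L : RatLabelledPointSet d) : List EncSym :=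
  encNat L.m ++ [bar] ++
    L.pts.attach.flatMap fun x => encPoint x.1 ++ [colon] ++ encNat (L.c x).1 ++ [semicolon]

/-- Encoding of a pair of a labelled point set and a bound `k`. -/
def encInstance {d : ℕ} (I : RatLabelledPointSet d × ℕ) : List EncSym :=
  encNat I.2 ++ [bar] ++ encLabelledPointSet I.1

end EncSym

/-- The function `f` is computable by a Turing machine, on inputs encoded by `ea` and outputs
encoded by `eb`, in time bounded by a polynomial in the length of the encoded input. -/
def PolyTimeComputable {α β αΓ βΓ : Type} (ea : α → List αΓ) (eb : β → List βΓ) (f : α → β) :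
    Prop :=
  Nonempty (Turing.TM2ComputableInPolyTime ea eb f)

open Classical in
/-- The decision problem with set `S` of yes-instances, on instances encoded by `ea`,
is solvable in deterministic polynomial time. -/
def InP {α αΓ : Type} (ea : α → List αΓ) (S : Set α) : Prop :=
  PolyTimeComputable ea Computability.encodeBool fun a => decide (a ∈ S)

/-- The yes-instances of the minimum cardinality reduced training set problem in `ℝ^d`: the
labelled point sets that have a reduced training set of at most `k` points, paired with `k`. -/
def MinReducedTrainingSet (d : ℕ) : Set (RatLabelledPointSet d × ℕ) :=
  {I | ∃ Q, I.1.toLabelledPointSet.IsReducedTrainingSet Q ∧ Q.card ≤ I.2}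

/-! On the line, the classification induced by `P` changes exactly at the midpoints of neighboring
points `u < v` of `P` with different labels. A nonempty `Q ⊆ P` induces the same classification iff
each such midpoint is also the midpoint of two neighbors `q < p` of `Q` with `q ≤ u` and `v ≤ p`
(`sameClassification_iff`). Labels of `q` and `p` need not be mentioned: if `q` and `u` had
different labels, a second change would lie in the gap between `q` and `p`, but a gap has only one
midpoint.

This condition is local. For `Q` written in increasing order it says that no change lies before the
first point, none lies after the last one, and every change inside a gap between successive points
has the midpoint of that gap. Reduced training sets of a nonempty `P` are therefore the paths of an
acyclic graph on the sorted points (`isPath_iff`, `isPath_start_iff`), and a minimum one is a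
shortest path. The dynamic program `paths` keeps at most one shortest path per starting point, so it
stores at most `|P|` sublists of `P` (`paths_sound`, `paths_complete`, `length_paths_le`). The
decision problem compares the length of the result with `k`.

For the time bound, data are binary trees, kept on a stack in Polish notation. The class `PolyTime`
of functions on trees is closed under composition, pairing, case distinction and folds whose
accumulators have polynomially bounded size (`PolyTime.foldl`, `PolyTime.listRec`). Binary
arithmetic, parsing, sorting and the shortest path search are built from these operations, and
structured stack programs are compiled to Turing machines (`StackProg.polyTimeComputable`). -/

/-! ### Structured stack programs and their compilation to Turing machines. -/

/-- Structured programs over finitely many stacks with symbols `Γ k` and a finite memory `σ`. -/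
inductive StackProg {K : Type} (Γ : K → Type) (σ : Type) : Type
  | load (f : σ → σ)
  | push (k : K) (f : σ → Γ k)
  | pop (k : K) (f : σ → Option (Γ k) → σ)
  | seq (p q : StackProg Γ σ)
  | ite (b : σ → Bool) (p q : StackProg Γ σ)
  | loop (b : σ → Bool) (p : StackProg Γ σ)

namespace StackProg

variable {K : Type} [DecidableEq K] {Γ : K → Type} {σ : Type}

/-- `Exec p v S v' S' t`: started with memory `v` and stacks `S`, the program `p` terminates
after at most `t` steps with memory `v'` and stacks `S'`. -/
inductive Exec : StackProg Γ σ → σ → (∀ k, List (Γ k)) → σ → (∀ k, List (Γ k)) → ℕ → Prop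
  | load (f v S) : Exec (load f) v S (f v) S 1
  | push (k f v S) : Exec (push k f) v S v (Function.update S k (f v :: S k)) 1
  | pop (k f v S) :
      Exec (pop k f) v S (f v (S k).head?) (Function.update S k (S k).tail) 1
  | seq {p q v S v₁ S₁ v₂ S₂ t₁ t₂} : Exec p v S v₁ S₁ t₁ → Exec q v₁ S₁ v₂ S₂ t₂ →
      Exec (seq p q) v S v₂ S₂ (t₁ + t₂)
  | ite_pos {b : σ → Bool} {p q v S v₁ S₁ t} : b v = true → Exec p v S v₁ S₁ t →
      Exec (ite b p q) v S v₁ S₁ (t + 1)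
  | ite_neg {b : σ → Bool} {p q v S v₁ S₁ t} : b v = false → Exec q v S v₁ S₁ t →
      Exec (ite b p q) v S v₁ S₁ (t + 1)
  | loop_neg {b : σ → Bool} {p v S} : b v = false → Exec (loop b p) v S v S 1
  | loop_pos {b : σ → Bool} {p v S v₁ S₁ v₂ S₂ t₁ t₂} : b v = true → Exec p v S v₁ S₁ t₁ →
      Exec (loop b p) v₁ S₁ v₂ S₂ t₂ → Exec (loop b p) v S v₂ S₂ (t₁ + t₂ + 1)
  | mono {p v S v' S' t t'} : Exec p v S v' S' t → t ≤ t' → Exec p v S v' S' t'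

/-- The control points of a program. -/
def Label : StackProg Γ σ → Type
  | load _ | push _ _ | pop _ _ => Unit
  | seq p q => Label p ⊕ Label q
  | ite _ p q => Option (Label p ⊕ Label q)
  | loop _ p => Option (Label p)

/-- The initial control point of a program. -/
def entry : (p : StackProg Γ σ) → Label p
  | load _ | push _ _ | pop _ _ => ()
  | seq p _ => Sum.inl (entry p)
  | ite _ _ _ => none
  | loop _ _ => none

/-- There are finitely many control points. -/
@[reducible] def fintypeLabel : (p : StackProg Γ σ) → Fintype (Label p)
  | load _ | push _ _ | pop _ _ => inferInstanceAs (Fintype Unit)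
  | seq p q =>
    letI := fintypeLabel p; letI := fintypeLabel q
    inferInstanceAs (Fintype (Label p ⊕ Label q))
  | ite _ p q =>
    letI := fintypeLabel p; letI := fintypeLabel q
    inferInstanceAs (Fintype (Option (Label p ⊕ Label q)))
  | loop _ p =>
    letI := fintypeLabel p
    inferInstanceAs (Fintype (Option (Label p)))

open Turing in
/-- The statement executed at a control point, when the control points are embedded into `Λ` by
`e` and the program continues at `exit`. -/
def code {Λ : Type} : (p : StackProg Γ σ) → (Label p → Λ) → Λ → Label p → TM2.Stmt Γ Λ σ
  | load f, _, exit, _ => .load f (.goto fun _ => exit)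
  | push k f, _, exit, _ => .push k f (.goto fun _ => exit)
  | pop k f, _, exit, _ => .pop k f (.goto fun _ => exit)
  | seq p q, e, _, Sum.inl l => code p (fun l => e (Sum.inl l)) (e (Sum.inr (entry q))) l
  | seq _ q, e, exit, Sum.inr l => code q (fun l => e (Sum.inr l)) exit l
  | ite b p q, e, _, none => .branch b (.goto fun _ => e (some (Sum.inl (entry p))))
      (.goto fun _ => e (some (Sum.inr (entry q))))
  | ite _ p _, e, exit, some (Sum.inl l) => code p (fun l => e (some (Sum.inl l))) exit l
  | ite _ _ q, e, exit, some (Sum.inr l) => code q (fun l => e (some (Sum.inr l))) exit l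
  | loop b p, e, exit, none => .branch b (.goto fun _ => e (some (entry p)))
      (.goto fun _ => exit)
  | loop _ p, e, _, some l => code p (fun l => e (some l)) (e none) l

-- Every primitive and every test is one machine step, which is what `Exec` charges; sequencing is
-- free because the exit of the first program is the entry of the second. The embedding `e` and the
-- exit are arbitrary so that the induction applies to subprograms inside a larger machine.
open Turing in
theorem Exec.reaches {p : StackProg Γ σ} {v S v' S' t} (h : Exec p v S v' S' t) {Λ : Type}
    (M : Λ → TM2.Stmt Γ Λ σ) (e : Label p → Λ) (exit : Λ)
    (hM : ∀ l, M (e l) = code p e exit l) :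
    ∃ n ≤ t, (flip bind (TM2.step M))^[n] (some ⟨some (e (entry p)), v, S⟩) =
      some ⟨some exit, v', S'⟩ := by
  induction h generalizing exit with
  | load f v S => exact ⟨1, le_rfl, by simp [flip, TM2.step, hM, code, TM2.stepAux]⟩
  | push k f v S => exact ⟨1, le_rfl, by simp [flip, TM2.step, hM, code, TM2.stepAux]⟩
  | pop k f v S => exact ⟨1, le_rfl, by simp [flip, TM2.step, hM, code, TM2.stepAux]⟩
  | @seq p q _ _ _ _ _ _ _ _ _ _ ih₁ ih₂ =>
    obtain ⟨n₁, h₁, e₁⟩ := ih₁ (fun l => e (Sum.inl l)) (e (Sum.inr (entry q)))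
      fun l => hM (Sum.inl l)
    obtain ⟨n₂, h₂, e₂⟩ := ih₂ (fun l => e (Sum.inr l)) exit fun l => hM (Sum.inr l)
    refine ⟨n₂ + n₁, by omega, ?_⟩
    rw [Function.iterate_add_apply, ← e₂, ← e₁]; rfl
  | @ite_pos b p q v S _ _ _ hb _ ih =>
    obtain ⟨n, h, e₁⟩ := ih (fun l => e (some (Sum.inl l))) exit
      fun l => hM (some (Sum.inl l))
    refine ⟨n + 1, by omega, ?_⟩
    rw [Function.iterate_add_apply, ← e₁]
    have := hM none
    simp [flip, TM2.step, entry, this, code, TM2.stepAux, hb]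
  | @ite_neg b p q v S _ _ _ hb _ ih =>
    obtain ⟨n, h, e₁⟩ := ih (fun l => e (some (Sum.inr l))) exit
      fun l => hM (some (Sum.inr l))
    refine ⟨n + 1, by omega, ?_⟩
    rw [Function.iterate_add_apply, ← e₁]
    have := hM none
    simp [flip, TM2.step, entry, this, code, TM2.stepAux, hb]
  | @loop_neg b p v S hb =>
    refine ⟨1, le_rfl, ?_⟩
    have := hM none
    simp [flip, TM2.step, entry, this, code, TM2.stepAux, hb]
  | @loop_pos b p v S _ _ _ _ _ _ hb _ _ ih₁ ih₂ =>
    -- The body of the loop returns to the test, so its exit is the entry of the loop.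
    obtain ⟨n₁, h₁, e₁⟩ := ih₁ (fun l => e (some l)) (e none) fun l => hM (some l)
    obtain ⟨n₂, h₂, e₂⟩ := ih₂ e exit hM
    refine ⟨n₂ + n₁ + 1, by omega, ?_⟩
    rw [Function.iterate_add_apply, Function.iterate_add_apply, ← e₂]
    have := hM none
    refine congrArg _ (Eq.trans ?_ e₁)
    simp [flip, TM2.step, entry, this, code, TM2.stepAux, hb]
  | mono _ hle ih =>
    obtain ⟨n, h, e₁⟩ := ih e exit hM
    exact ⟨n, h.trans hle, e₁⟩

/-- The Turing machine that runs a program. -/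
def machine [Fintype K] [Fintype σ] (p : StackProg Γ σ) (k₀ k₁ : K) [Fintype (Γ k₀)] (v : σ) :
    Turing.FinTM2 :=
  letI := fintypeLabel p
  { K := K
    k₀ := k₀
    k₁ := k₁
    Γ := Γ
    Λ := Option (Label p)
    main := some (entry p)
    σ := σ
    initialState := v
    m := fun l => match l with
      | none => .halt
      | some l => code p some none l }

/-- The left-hand side is the form in which `Turing.initList` and `Turing.haltList` give their
stacks. -/
theorem dite_eq_update (k₀ : K) (s : List (Γ k₀)) :
    (fun k => dite (k = k₀) (fun h => by rw [h]; exact s) fun _ => []) =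
      Function.update (fun k => ([] : List (Γ k))) k₀ s := by
  funext k
  by_cases hk : k = k₀
  · subst hk; simp
  · simp [hk]

/-- A program that turns every encoded input into the encoded output within polynomial time
witnesses polynomial time computability. -/
theorem polyTimeComputable [Fintype K] [Fintype σ] {α β αΓ βΓ : Type} [Fintype αΓ]
    (ea : α → List αΓ) (eb : β → List βΓ) (f : α → β) (p : StackProg Γ σ) (k₀ k₁ : K) (v : σ)
    (i₀ : Γ k₀ ≃ αΓ) (i₁ : Γ k₁ ≃ βΓ) (T : Polynomial ℕ)
    (h : ∀ a, Exec p v (Function.update (fun _ => []) k₀ ((ea a).map i₀.symm)) v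
      (Function.update (fun _ => []) k₁ ((eb (f a)).map i₁.symm)) (T.eval (ea a).length)) :
    PolyTimeComputable ea eb f := by
  let _ : Fintype (Γ k₀) := Fintype.ofEquiv αΓ i₀.symm
  refine ⟨{ tm := machine p k₀ k₁ v, inputAlphabet := i₀, outputAlphabet := i₁, time := T + 1,
            outputsFun := fun a => Classical.choice ?_ }⟩
  obtain ⟨n, hn, e⟩ := (h a).reaches (machine p k₀ k₁ v).m some none (fun l => rfl)
  -- The additional step executes the halting statement at the exit label.
  refine ⟨⟨⟨n + 1, ?_⟩, by simpa using hn⟩⟩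
  have h₀ : Turing.initList (machine p k₀ k₁ v) ((ea a).map i₀.symm) =
      ⟨some (some (entry p)), v, Function.update (fun _ => []) k₀ ((ea a).map i₀.symm)⟩ := by
    exact congrArg _ (dite_eq_update k₀ _)
  have h₁ : Turing.haltList (machine p k₀ k₁ v) ((eb (f a)).map i₁.symm) =
      ⟨none, v, Function.update (fun _ => []) k₁ ((eb (f a)).map i₁.symm)⟩ := by
    exact congrArg _ (dite_eq_update k₁ _)
  rw [add_comm, Function.iterate_add_apply]
  refine Eq.trans (congrArg _ ((congrArg _ (congrArg some h₀)).trans e)) ?_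
  exact congrArg some h₁.symm

end StackProg

/-! ### Stack programs that move, copy and delete serialized trees. -/

/-- Binary trees with leaves in the alphabet of the encodings. -/
inductive Datum : Type
  | leaf (s : EncSym)
  | node (x y : Datum)

/-- The symbols of the serialization of binary trees. -/
inductive TreeSym : Type
  | node
  | leaf (s : EncSym)
  deriving DecidableEq, Fintype

/-- Serialization of a tree in Polish notation. -/
def Datum.ser : Datum → List TreeSym
  | leaf s => [TreeSym.leaf s]
  | node x y => TreeSym.node :: (ser x ++ ser y)

/-- Lets additive constants in running times be absorbed into multiples of the length. -/
theorem Datum.ser_length_pos (x : Datum) : 0 < x.ser.length := by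
  cases x <;> simp [Datum.ser]

/-- The stacks of a tree machine: the main stack, two auxiliary stacks, a unary counter, the input
stack, and two possible output stk. -/
inductive TreeStack : Type
  | main
  | left
  | right
  | count
  | inp
  | outWord
  | outBit
  deriving DecidableEq

instance : Fintype TreeStack :=
  ⟨{.main, .left, .right, .count, .inp, .outWord, .outBit}, fun k => by cases k <;> decide⟩

/-- The alphabets of the stk. -/
abbrev TreeStack.Alphabet : TreeStack → Type
  | main | left | right | count => TreeSym
  | inp | outWord => EncSym
  | outBit => Bool

/-- Programs of tree machines; their memory holds at most one symbol. -/
abbrev TreeProg : Type := StackProg TreeStack.Alphabet (Option TreeSym)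

namespace TreeProg

open StackProg TreeStack

/-- The stacks with the given contents. -/
def stk (i o : List EncSym) (u : List Bool) (d a b c : List TreeSym) :
    ∀ k : TreeStack, List (Alphabet k)
  | .main => d
  | .left => a
  | .right => b
  | .count => c
  | .inp => i
  | .outWord => o
  | .outBit => u

section
variable (i o : List EncSym) (u : List Bool) (d a b c x : List TreeSym)

@[simp] theorem update_main : Function.update (stk i o u d a b c) .main x =
    stk i o u x a b c := by funext k; cases k <;> rfl

@[simp] theorem update_left : Function.update (stk i o u d a b c) .left x =
    stk i o u d x b c := by funext k; cases k <;> rfl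

@[simp] theorem update_right : Function.update (stk i o u d a b c) .right x =
    stk i o u d a x c := by funext k; cases k <;> rfl

@[simp] theorem update_count : Function.update (stk i o u d a b c) .count x =
    stk i o u d a b x := by funext k; cases k <;> rfl

@[simp] theorem update_inp (y : List EncSym) : Function.update (stk i o u d a b c) .inp y =
    stk y o u d a b c := by funext k; cases k <;> rfl

@[simp] theorem update_outWord (y : List EncSym) :
    Function.update (stk i o u d a b c) .outWord y =
    stk i y u d a b c := by funext k; cases k <;> rfl

@[simp] theorem update_outBit (y : List Bool) :
    Function.update (stk i o u d a b c) .outBit y =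
    stk i o y d a b c := by funext k; cases k <;> rfl

end

/-- The empty program. -/
def nop : TreeProg := load id

/-- Pop the main stack into the memory. -/
def popMain : TreeProg := pop .main fun _ s => s

/-- Push the symbol in the memory to the main stack. -/
def pushMain : TreeProg := push .main fun v => v.getD .node

/-- The memory holds the given symbol. -/
def holds (s : TreeSym) (v : Option TreeSym) : Bool := v == some s

/-- The memory holds a symbol. -/
def holdsAny (v : Option TreeSym) : Bool := v.isSome

section Transport

variable {i o : List EncSym} {u : List Bool} {d a b c : List TreeSym} {v : Option TreeSym}

theorem exec_popMain : Exec popMain v (stk i o u d a b c) d.head?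
    (stk i o u d.tail a b c) 1 := by
  have h := Exec.pop (Γ := Alphabet) .main (fun _ s => s) v (stk i o u d a b c)
  rw [update_main] at h
  exact h

theorem exec_pushMain : Exec pushMain v (stk i o u d a b c) v
    (stk i o u (v.getD .node :: d) a b c) 1 := by
  have h := Exec.push (Γ := Alphabet) .main (fun v => v.getD .node) v (stk i o u d a b c)
  rw [update_main] at h
  exact h

theorem exec_popLeft : Exec (pop .left fun _ s => s) v (stk i o u d a b c) a.head?
    (stk i o u d a.tail b c) 1 := by
  have h := Exec.pop (Γ := Alphabet) .left (fun _ s => s) v (stk i o u d a b c)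
  rw [update_left] at h
  exact h

theorem exec_popRight : Exec (pop .right fun _ s => s) v (stk i o u d a b c) b.head?
    (stk i o u d a b.tail c) 1 := by
  have h := Exec.pop (Γ := Alphabet) .right (fun _ s => s) v (stk i o u d a b c)
  rw [update_right] at h
  exact h

theorem exec_popCount : Exec (pop .count fun _ s => s) v (stk i o u d a b c) c.head?
    (stk i o u d a b c.tail) 1 := by
  have h := Exec.pop (Γ := Alphabet) .count (fun _ s => s) v (stk i o u d a b c)
  rw [update_count] at h
  exact h

theorem exec_pushLeft : Exec (push .left fun v => v.getD .node) v (stk i o u d a b c) v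
    (stk i o u d (v.getD .node :: a) b c) 1 := by
  have h := Exec.push (Γ := Alphabet) .left (fun v => v.getD .node) v (stk i o u d a b c)
  rw [update_left] at h
  exact h

theorem exec_pushRight : Exec (push .right fun v => v.getD .node) v (stk i o u d a b c) v
    (stk i o u d a (v.getD .node :: b) c) 1 := by
  have h := Exec.push (Γ := Alphabet) .right (fun v => v.getD .node) v (stk i o u d a b c)
  rw [update_right] at h
  exact h

theorem exec_pushCount : Exec (push .count fun _ => .node) v (stk i o u d a b c) v
    (stk i o u d a b (.node :: c)) 1 := by
  have h := Exec.push (Γ := Alphabet) .count (fun _ => .node) v (stk i o u d a b c)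
  rw [update_count] at h
  exact h

/-- Adjust the counter of the trees still to be read, after a symbol has been read. -/
def adjust : TreeProg :=
  seq (ite (holds .node) (seq (push .count fun _ => .node) (push .count fun _ => .node)) nop)
    (pop .count fun _ s => s)

/-- While a tree is being moved, the memory holds a symbol as long as something remains to be read,
and the counter holds one symbol for each further tree. A node replaces the current tree by two, a
leaf completes it; popping the counter then refills the memory or clears it. -/
theorem exec_adjust_node : Exec adjust (some .node) (stk i o u d a b c) (some .node)
    (stk i o u d a b (.node :: c)) 4 :=
  (Exec.ite_pos rfl (exec_pushCount.seq exec_pushCount)).seq exec_popCount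

theorem exec_adjust_leaf {s : EncSym} : Exec adjust (some (.leaf s)) (stk i o u d a b c)
    c.head? (stk i o u d a b c.tail) 4 :=
  ((Exec.ite_neg rfl (Exec.load id _ _)).seq exec_popCount).mono (by norm_num)

/-- Move trees from the main stack to the left stack, as many as the counter says. -/
def takeLeftLoop : TreeProg :=
  loop holdsAny (seq popMain (seq (push .left fun v => v.getD .node) adjust))

/-- Move a tree from the main stack to the left stack. -/
def takeLeft : TreeProg := seq (load fun _ => some .node) takeLeftLoop

/-- Move trees from the main stack to the right stack, as many as the counter says. -/
def takeRightLoop : TreeProg :=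
  loop holdsAny (seq popMain (seq (push .right fun v => v.getD .node) adjust))

/-- Move a tree from the main stack to the right stack. -/
def takeRight : TreeProg := seq (load fun _ => some .node) takeRightLoop

/-- The continuation after `x` has been moved is a hypothesis, so at a node the statements for the
two subtrees simply chain. Each symbol costs 7 steps: the loop test, a pop, a push and 4 for
`adjust`. -/
theorem exec_takeLeftLoop (x : Datum) : ∀ {s : TreeSym} {d a c : List TreeSym} {v' S' t},
    Exec takeLeftLoop c.head? (stk i o u d (x.ser.reverse ++ a) b c.tail) v' S' t →
    Exec takeLeftLoop (some s) (stk i o u (x.ser ++ d) a b c) v' S'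
      (7 * x.ser.length + t) := by
  induction x with
  | leaf l =>
    intro s d a c v' S' t h
    have h1 := exec_popMain (v := some s) (i := i) (o := o) (u := u)
      (d := TreeSym.leaf l :: d) (a := a) (b := b) (c := c)
    exact (Exec.loop_pos rfl (h1.seq (exec_pushLeft.seq exec_adjust_leaf)) h).mono
      (by simp only [Datum.ser, List.length_singleton]; omega)
  | node x y ihx ihy =>
    intro s d a c v' S' t h
    have h1 := exec_popMain (v := some s) (i := i) (o := o) (u := u)
      (d := TreeSym.node :: (x.ser ++ (y.ser ++ d))) (a := a) (b := b) (c := c)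
    have h2 : Exec takeLeftLoop _ _ _ _ _ := Exec.loop_pos rfl
      (h1.seq (exec_pushLeft.seq exec_adjust_node))
      (ihx (c := .node :: c) (ihy (c := c) (by simpa [Datum.ser] using h)))
    simpa [Datum.ser] using h2.mono (t' := 7 * (Datum.node x y).ser.length + t)
      (by simp only [Datum.ser, List.length_cons, List.length_append]; omega)

theorem exec_takeLeft (x : Datum) :
    Exec takeLeft v (stk i o u (x.ser ++ d) a b []) none
      (stk i o u d (x.ser.reverse ++ a) b []) (7 * x.ser.length + 2) :=
  ((Exec.load _ _ _).seq (exec_takeLeftLoop x (c := []) (Exec.loop_neg rfl))).mono (by omega)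

theorem exec_takeRightLoop (x : Datum) : ∀ {s : TreeSym} {d b c : List TreeSym} {v' S' t},
    Exec takeRightLoop c.head? (stk i o u d a (x.ser.reverse ++ b) c.tail) v' S' t →
    Exec takeRightLoop (some s) (stk i o u (x.ser ++ d) a b c) v' S'
      (7 * x.ser.length + t) := by
  induction x with
  | leaf l =>
    intro s d b c v' S' t h
    have h1 := exec_popMain (v := some s) (i := i) (o := o) (u := u)
      (d := TreeSym.leaf l :: d) (a := a) (b := b) (c := c)
    exact (Exec.loop_pos rfl (h1.seq (exec_pushRight.seq exec_adjust_leaf)) h).mono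
      (by simp only [Datum.ser, List.length_singleton]; omega)
  | node x y ihx ihy =>
    intro s d b c v' S' t h
    have h1 := exec_popMain (v := some s) (i := i) (o := o) (u := u)
      (d := TreeSym.node :: (x.ser ++ (y.ser ++ d))) (a := a) (b := b) (c := c)
    have h2 : Exec takeRightLoop _ _ _ _ _ := Exec.loop_pos rfl
      (h1.seq (exec_pushRight.seq exec_adjust_node))
      (ihx (c := .node :: c) (ihy (c := c) (by simpa [Datum.ser] using h)))
    simpa [Datum.ser] using h2.mono (t' := 7 * (Datum.node x y).ser.length + t)
      (by simp only [Datum.ser, List.length_cons, List.length_append]; omega)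

theorem exec_takeRight (x : Datum) :
    Exec takeRight v (stk i o u (x.ser ++ d) a b []) none
      (stk i o u d a (x.ser.reverse ++ b) []) (7 * x.ser.length + 2) :=
  ((Exec.load _ _ _).seq (exec_takeRightLoop x (c := []) (Exec.loop_neg rfl))).mono (by omega)

/-- The transfer loops are entered with the top symbol already popped into the memory; an empty
memory signals that the stack is exhausted. -/
theorem exec_left_loop_main : ∀ {a d : List TreeSym},
    Exec (loop holdsAny (seq pushMain (pop .left fun _ s => s))) a.head?
      (stk i o u d a.tail b c) none (stk i o u (a.reverse ++ d) [] b c) (3 * a.length + 1)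
  | [], d => Exec.loop_neg rfl
  | s :: a, d => by
    have h := Exec.loop_pos (b := holdsAny) rfl
      ((exec_pushMain (v := some s) (d := d)).seq exec_popLeft)
      (exec_left_loop_main (a := a) (d := s :: d))
    simpa using h.mono (t' := 3 * (s :: a).length + 1) (by simp only [List.length_cons]; omega)

theorem exec_right_loop_main : ∀ {b d : List TreeSym},
    Exec (loop holdsAny (seq pushMain (pop .right fun _ s => s))) b.head?
      (stk i o u d a b.tail c) none (stk i o u (b.reverse ++ d) a [] c) (3 * b.length + 1)
  | [], d => Exec.loop_neg rfl
  | s :: b, d => by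
    have h := Exec.loop_pos (b := holdsAny) rfl
      ((exec_pushMain (v := some s) (d := d)).seq exec_popRight)
      (exec_right_loop_main (b := b) (d := s :: d))
    simpa using h.mono (t' := 3 * (s :: b).length + 1) (by simp only [List.length_cons]; omega)

theorem exec_right_loop_left : ∀ {b a : List TreeSym},
    Exec (loop holdsAny (seq (push .left fun v => v.getD .node) (pop .right fun _ s => s))) b.head?
      (stk i o u d a b.tail c) none (stk i o u d (b.reverse ++ a) [] c) (3 * b.length + 1)
  | [], a => Exec.loop_neg rfl
  | s :: b, a => by
    have h := Exec.loop_pos (b := holdsAny) rfl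
      ((exec_pushLeft (v := some s) (a := a)).seq exec_popRight)
      (exec_right_loop_left (b := b) (a := s :: a))
    simpa using h.mono (t' := 3 * (s :: b).length + 1) (by simp only [List.length_cons]; omega)

theorem exec_left_loop_both : ∀ {a b d : List TreeSym},
    Exec (loop holdsAny (seq pushMain (seq (push .right fun v => v.getD .node)
        (pop .left fun _ s => s)))) a.head?
      (stk i o u d a.tail b c) none (stk i o u (a.reverse ++ d) [] (a.reverse ++ b) c)
      (4 * a.length + 1)
  | [], b, d => Exec.loop_neg rfl
  | s :: a, b, d => by
    have h := Exec.loop_pos (b := holdsAny) rfl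
      ((exec_pushMain (v := some s) (d := d)).seq (exec_pushRight.seq exec_popLeft))
      (exec_left_loop_both (a := a) (b := s :: b)
        (d := s :: d))
    simpa using h.mono (t' := 4 * (s :: a).length + 1) (by simp only [List.length_cons]; omega)

theorem exec_left_loop_nop : ∀ {a : List TreeSym},
    Exec (loop holdsAny (pop .left fun _ s => s)) a.head?
      (stk i o u d a.tail b c) none (stk i o u d [] b c) (2 * a.length + 1)
  | [] => Exec.loop_neg rfl
  | s :: a => by
    have h := Exec.loop_pos (b := holdsAny) rfl (exec_popLeft (v := some s))
      (exec_left_loop_nop (a := a))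
    simpa using h.mono (t' := 2 * (s :: a).length + 1) (by simp only [List.length_cons]; omega)

/-- Move the left stack to the main stack. -/
def leftToMain : TreeProg :=
  seq (pop .left fun _ s => s) (loop holdsAny (seq pushMain (pop .left fun _ s => s)))

theorem exec_leftToMain : Exec leftToMain v (stk i o u d a b c) none
    (stk i o u (a.reverse ++ d) [] b c) (3 * a.length + 2) :=
  (exec_popLeft.seq exec_left_loop_main).mono (by omega)

/-- Move the right stack to the main stack. -/
def rightToMain : TreeProg :=
  seq (pop .right fun _ s => s) (loop holdsAny (seq pushMain (pop .right fun _ s => s)))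

theorem exec_rightToMain : Exec rightToMain v (stk i o u d a b c) none
    (stk i o u (b.reverse ++ d) a [] c) (3 * b.length + 2) :=
  (exec_popRight.seq exec_right_loop_main).mono (by omega)

end Transport

/-- `Runs p T x y`: within `T` steps, `p` replaces the word `x` on top of the main stack by `y`;
all other stacks are empty before and after. -/
def Runs (p : TreeProg) (T : ℕ) (x y : List TreeSym) : Prop :=
  ∀ v w, ∃ v', Exec p v (stk [] [] [] (x ++ w) [] [] []) v' (stk [] [] [] (y ++ w) [] [] []) T

namespace Runs

variable {p q : TreeProg} {T T' : ℕ} {x y z w : List TreeSym}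

theorem mono (h : Runs p T x y) (hT : T ≤ T') : Runs p T' x y := fun v w =>
  (h v w).imp fun _ h => h.mono hT

theorem seq (h : Runs p T x y) (h' : Runs q T' y z) : Runs (seq p q) (T + T') x z := by
  intro v w
  obtain ⟨v₁, h₁⟩ := h v w
  obtain ⟨v₂, h₂⟩ := h' v₁ w
  exact ⟨v₂, h₁.seq h₂⟩

theorem frame (h : Runs p T x y) (w : List TreeSym) : Runs p T (x ++ w) (y ++ w) := by
  intro v w'
  simpa using h v (w ++ w')

end Runs

variable {p q : TreeProg} {T T' : ℕ} {x y z w : List TreeSym}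

theorem runs_nop : Runs nop 1 x x := fun _ _ => ⟨_, Exec.load _ _ _⟩

/-- Push a fixed symbol. -/
def put (s : TreeSym) : TreeProg := push .main fun _ => s

theorem runs_put (s : TreeSym) : Runs (put s) 1 x (s :: x) := fun v w =>
  ⟨v, by
    have h := Exec.push (Γ := Alphabet) .main (fun _ => s) v (stk [] [] [] (x ++ w) [] [] [])
    rw [update_main] at h
    exact h⟩

theorem runs_popMain {s : TreeSym} : Runs popMain 1 (s :: x) x := fun v w =>
  ⟨some s, exec_popMain (v := v) (i := []) (o := []) (u := [])
    (d := s :: (x ++ w)) (a := []) (b := []) (c := [])⟩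

/-- Replace the topmost symbol. -/
def replaceTop (f : TreeSym → TreeSym) : TreeProg :=
  .seq (.pop .main fun _ s => s.map f) pushMain

theorem runs_replaceTop (f : TreeSym → TreeSym) {s : TreeSym} :
    Runs (replaceTop f) 2 (s :: x) (f s :: x) := fun v w => by
  have h := Exec.pop (Γ := Alphabet) .main (fun _ s => s.map f) v
    (stk [] [] [] (s :: (x ++ w)) [] [] [])
  rw [update_main] at h
  exact ⟨_, h.seq exec_pushMain⟩

/-- Duplicate the topmost tree. -/
def dup : TreeProg :=
  .seq takeLeft (.seq
    (.seq (.pop .left fun _ s => s) (loop holdsAny (.seq pushMain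
      (.seq (push .right fun v => v.getD .node) (.pop .left fun _ s => s)))))
    (.seq (.seq (.pop .right fun _ s => s) (loop holdsAny
      (.seq (push .left fun v => v.getD .node) (.pop .right fun _ s => s)))) leftToMain))

/-- Emptying one stack onto another reverses the word, so the second copy, made on the right stack,
passes through the left stack before it returns to the main one. -/
theorem runs_dup (x : Datum) : Runs dup (30 * x.ser.length) x.ser (x.ser ++ x.ser) := by
  intro v w
  have hpos := x.ser_length_pos
  have h : Exec dup _ _ _ _ _ := (exec_takeLeft (v := v) (i := []) (o := []) (u := []) (a := []) (b := []) (d := w)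
    x).seq ((exec_popLeft.seq exec_left_loop_both).seq
      ((exec_popRight.seq exec_right_loop_left).seq exec_leftToMain))
  refine ⟨none, ?_⟩
  simpa using h.mono (t' := 30 * x.ser.length) (by simp; omega)

/-- Exchange the two topmost trees. -/
def swap : TreeProg := .seq takeLeft (.seq takeRight (.seq leftToMain rightToMain))

theorem runs_swap (x y : Datum) :
    Runs swap (15 * (x.ser.length + y.ser.length)) (x.ser ++ y.ser) (y.ser ++ x.ser) := by
  intro v w
  have hpos := x.ser_length_pos
  have hpos := y.ser_length_pos
  have h : Exec swap _ _ _ _ _ := (exec_takeLeft (v := v) (i := []) (o := []) (u := []) (a := []) (b := [])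
    (d := y.ser ++ w) x).seq ((exec_takeRight y).seq
      (exec_leftToMain.seq exec_rightToMain))
  refine ⟨none, ?_⟩
  simpa using h.mono (t' := 15 * (x.ser.length + y.ser.length)) (by simp; omega)

/-- Remove the topmost tree. -/
def drop : TreeProg :=
  .seq takeLeft (.seq (.pop .left fun _ s => s) (loop holdsAny (.pop .left fun _ s => s)))

theorem runs_drop (x : Datum) : Runs drop (15 * x.ser.length) x.ser [] := by
  intro v w
  have hpos := x.ser_length_pos
  have h : Exec drop _ _ _ _ _ := (exec_takeLeft (v := v) (i := []) (o := []) (u := []) (a := []) (b := [])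
    (d := w) x).seq (exec_popLeft.seq exec_left_loop_nop)
  refine ⟨none, ?_⟩
  simpa using h.mono (t' := 15 * x.ser.length) (by simp; omega)

/-- Branch on whether the topmost symbol is `s`, and remove it. -/
def test (s : TreeSym) (p q : TreeProg) : TreeProg := .seq popMain (.ite (holds s) p q)

theorem runs_test_pos {s : TreeSym} (h : Runs p T x y) : Runs (test s p q) (T + 2) (s :: x) y := by
  intro v w
  obtain ⟨v', h⟩ := h (some s) w
  exact ⟨v', (Exec.seq (exec_popMain (d := s :: (x ++ w)))
    (Exec.ite_pos (by simp [holds]) h)).mono (by omega)⟩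

theorem runs_test_neg {s s' : TreeSym} (hs : s' ≠ s) (h : Runs q T x y) :
    Runs (test s p q) (T + 2) (s' :: x) y := by
  intro v w
  obtain ⟨v', h⟩ := h (some s') w
  exact ⟨v', (Exec.seq (exec_popMain (d := s' :: (x ++ w)))
    (Exec.ite_neg (by simpa [holds] using hs) h)).mono (by omega)⟩

end TreeProg

open StackProg TreeProg

/-! ### Tree representations of data and their sizes. -/

/-- A representation of the elements of a type by trees. -/
class TreeEnc (α : Type) where
  /-- the tree that represents an element -/
  enc : α → Datum

section TreeEnc

variable {α β : Type} [TreeEnc α] [TreeEnc β]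

/-- The serialized representation of an element. -/
def word (a : α) : List TreeSym := (TreeEnc.enc a).ser

/-- The length of the representation of an element. -/
def size (a : α) : ℕ := (word a).length

instance : TreeEnc EncSym := ⟨Datum.leaf⟩

instance : TreeEnc Bool := ⟨fun b => .leaf (.bit b)⟩

instance : TreeEnc (α × β) := ⟨fun x => .node (TreeEnc.enc x.1) (TreeEnc.enc x.2)⟩

/-- A nonempty list has the same tree as the pair of its head and its tail, and the topmost symbol
tells it from the empty list. `PolyTime.cons` and `PolyTime.listCase` rest on this. -/
instance : TreeEnc (List α) := ⟨fun l => l.foldr (fun a t => .node (TreeEnc.enc a) t) (.leaf .bar)⟩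

theorem word_sym (s : EncSym) : word s = [.leaf s] := rfl

theorem word_pair (x : α × β) : word x = .node :: (word x.1 ++ word x.2) := rfl

theorem word_nil : word ([] : List α) = [.leaf .bar] := rfl

theorem word_cons (a : α) (l : List α) : word (a :: l) = .node :: (word a ++ word l) := rfl

@[simp] theorem size_sym (s : EncSym) : size s = 1 := rfl

@[simp] theorem size_bool (b : Bool) : size b = 1 := rfl

@[simp] theorem size_pair (a : α) (b : β) : size (a, b) = size a + size b + 1 := by
  simp [size, word_pair]

@[simp] theorem size_nil : size ([] : List α) = 1 := rfl

@[simp] theorem size_cons (a : α) (l : List α) : size (a :: l) = size a + size l + 1 := by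
  simp [size, word_cons]

theorem size_append (l l' : List α) : size (l ++ l') + 1 = size l + size l' := by
  induction l with
  | nil => simp [add_comm]
  | cons a l ih => simp only [List.cons_append, size_cons]; omega

@[simp] theorem size_reverse (l : List α) : size l.reverse = size l := by
  induction l with
  | nil => rfl
  | cons a l ih =>
    have := size_append l.reverse [a]
    simp only [List.reverse_cons, size_cons, size_nil] at *
    omega

theorem length_le_size (l : List α) : l.length ≤ size l := by
  induction l with
  | nil => simp
  | cons a l ih => simp only [List.length_cons, size_cons]; omega

theorem size_le_of_sublist {l l' : List α} (h : l.Sublist l') : size l ≤ size l' := by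
  induction h with
  | slnil => rfl
  | cons a _ ih => simp only [size_cons]; omega
  | cons_cons a _ ih => simp only [size_cons]; omega

theorem size_le_of_mem {a : α} {l : List α} (h : a ∈ l) : size a ≤ size l := by
  have := size_le_of_sublist (List.singleton_sublist.2 h)
  simp only [size_cons] at this
  omega

theorem size_list_le {l : List α} {n : ℕ} (h : ∀ a ∈ l, size a ≤ n) :
    size l ≤ l.length * (n + 1) + 1 := by
  induction l with
  | nil => simp
  | cons a l ih =>
    have h₁ := h a (by simp)
    have h₂ := ih fun b hb => h b (by simp [hb])
    simp only [size_cons, List.length_cons, add_mul]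
    omega

end TreeEnc

namespace TreeProg

variable {α β : Type} [TreeEnc α] [TreeEnc β]

theorem runs_dup_word (a : α) : Runs dup (30 * size a) (word a) (word a ++ word a) :=
  runs_dup _

theorem runs_swap_word (a : α) (b : β) :
    Runs swap (15 * (size a + size b)) (word a ++ word b) (word b ++ word a) :=
  runs_swap _ _

end TreeProg

/-! ### Polynomial time functions on trees and their basic closure properties. -/

theorem Polynomial.eval_nat_mono (P : Polynomial ℕ) {m n : ℕ} (h : m ≤ n) :
    P.eval m ≤ P.eval n := by
  simp only [Polynomial.eval_eq_sum_range]
  gcongr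

variable {α β γ : Type} [TreeEnc α] [TreeEnc β] [TreeEnc γ]

/-- The function `f` is computed by a tree machine in polynomial time. -/
def PolyTime (f : α → β) : Prop :=
  ∃ (p : TreeProg) (P : Polynomial ℕ), ∀ a,
    Runs p (P.eval (size a)) (word a) (word (f a)) ∧ size (f a) ≤ P.eval (size a)

namespace PolyTime

theorem exists_size_le {f : α → β} (hf : PolyTime f) :
    ∃ P : Polynomial ℕ, ∀ a, size (f a) ≤ P.eval (size a) :=
  let ⟨_, P, h⟩ := hf
  ⟨P, fun a => (h a).2⟩

theorem of_word_eq {f : α → β} (h : ∀ a, word (f a) = word a) : PolyTime f :=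
  ⟨nop, Polynomial.X + 1, fun a => ⟨by
    rw [h]; exact runs_nop.mono (by simp), by simp [size, h]⟩⟩

protected theorem id : PolyTime fun a : α => a := of_word_eq fun _ => rfl

/-- The time of `g` is polynomial in the size of `f a`; the size bound included in `PolyTime` makes
it polynomial in the size of `a`. -/
theorem comp {g : β → γ} {f : α → β} (hg : PolyTime g) (hf : PolyTime f) :
    PolyTime fun a => g (f a) := by
  obtain ⟨p, P, hP⟩ := hf
  obtain ⟨q, Q, hQ⟩ := hg
  refine ⟨seq p q, P + Q.comp P, fun a => ⟨?_, ?_⟩⟩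
  · refine ((hP a).1.seq (hQ _).1).mono ?_
    simpa using Q.eval_nat_mono (hP a).2
  · simpa using ((hQ (f a)).2.trans (Q.eval_nat_mono (hP a).2)).trans (Nat.le_add_left _ _)

theorem pair {f : α → β} {g : α → γ} (hf : PolyTime f) (hg : PolyTime g) :
    PolyTime fun a => (f a, g a) := by
  obtain ⟨p, P, hP⟩ := hf
  obtain ⟨q, Q, hQ⟩ := hg
  -- The stack reads `a, a`, then `g a, a`, then `a, g a`, then `f a, g a`; the final node joins the
  -- two trees.
  refine ⟨seq dup (seq q (seq swap (seq p (put .node)))),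
    45 * Polynomial.X + P + 16 * Q + 1, fun a => ⟨?_, ?_⟩⟩
  · have h := (runs_dup_word a).seq (((hQ a).1.frame (word a)).seq
      ((runs_swap (TreeEnc.enc (g a)) (TreeEnc.enc a)).seq (((hP a).1.frame (word (g a))).seq
        (runs_put .node))))
    refine Runs.mono h ?_
    have := (hQ a).2
    simp only [size, word] at *
    simp
    omega
  · have := (hQ a).2
    have := (hP a).2
    simp
    omega

theorem fst : PolyTime fun x : α × β => x.1 := by
  refine ⟨seq popMain (seq swap drop), 40 * Polynomial.X + 40, fun x => ⟨?_, ?_⟩⟩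
  · have h := (runs_popMain (s := .node) (x := word x.1 ++ word x.2)).seq
      ((runs_swap (TreeEnc.enc x.1) (TreeEnc.enc x.2)).seq
        ((runs_drop (TreeEnc.enc x.2)).frame (word x.1)))
    refine Runs.mono h ?_
    have := size_pair x.1 x.2
    rw [Prod.mk.eta] at this
    simp only [size, word] at *
    simp
    omega
  · have := size_pair x.1 x.2
    rw [Prod.mk.eta] at this
    simp
    omega

theorem snd : PolyTime fun x : α × β => x.2 := by
  refine ⟨seq popMain drop, 40 * Polynomial.X + 40, fun x => ⟨?_, ?_⟩⟩
  · have h := (runs_popMain (s := .node) (x := word x.1 ++ word x.2)).seq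
      ((runs_drop (TreeEnc.enc x.1)).frame (word x.2))
    refine Runs.mono h ?_
    have := size_pair x.1 x.2
    rw [Prod.mk.eta] at this
    simp only [size, word] at *
    simp
    omega
  · have := size_pair x.1 x.2
    rw [Prod.mk.eta] at this
    simp
    omega

/-- A function all of whose values are represented by the same symbol. -/
theorem const_sym {f : α → β} (s : EncSym) (hs : ∀ a, word (f a) = [.leaf s]) : PolyTime f := by
  refine ⟨seq drop (put (.leaf s)), 15 * Polynomial.X + 1, fun a => ⟨?_, ?_⟩⟩
  · rw [hs]
    refine Runs.mono ((runs_drop (TreeEnc.enc a)).seq (runs_put _)) ?_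
    simp [size, word]
  · simp [size, hs]

theorem const_bool (b : Bool) : PolyTime fun _ : α => b := const_sym (.bit b) fun _ => rfl

theorem const_encSym (s : EncSym) : PolyTime fun _ : α => s := const_sym s fun _ => rfl

theorem nil : PolyTime fun _ : α => ([] : List β) := const_sym .bar fun _ => rfl

theorem cons {f : α → β} {g : α → List β} (hf : PolyTime f) (hg : PolyTime g) :
    PolyTime fun a => f a :: g a :=
  comp (f := fun a => (f a, g a)) (g := fun x : β × List β => x.1 :: x.2)
    (of_word_eq fun _ => rfl) (hf.pair hg)

/-- A function between types whose elements are represented by single symbols. -/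
theorem of_sym (φ : EncSym → EncSym) {f : α → β}
    (h : ∀ a, ∃ s, word a = [.leaf s] ∧ word (f a) = [.leaf (φ s)]) : PolyTime f := by
  refine ⟨replaceTop fun s => match s with | .node => .node | .leaf s => .leaf (φ s), 2,
    fun a => ?_⟩
  obtain ⟨s, h₁, h₂⟩ := h a
  exact ⟨by rw [h₁, h₂]; simpa using runs_replaceTop _, by simp [size, h₂]⟩

theorem sym_to_bool (φ : EncSym → Bool) : PolyTime φ :=
  of_sym (fun s => .bit (φ s)) fun s => ⟨s, rfl, rfl⟩

theorem bit : PolyTime EncSym.bit := of_word_eq fun _ => rfl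

theorem cond {c : α → Bool} {f g : α → β} (hc : PolyTime c) (hf : PolyTime f) (hg : PolyTime g) :
    PolyTime fun a => bif c a then f a else g a := by
  obtain ⟨r, R, hR⟩ := hc
  obtain ⟨p, P, hP⟩ := hf
  obtain ⟨q, Q, hQ⟩ := hg
  refine ⟨seq (seq dup r) (test (.leaf (.bit true)) p q), 30 * Polynomial.X + R + P + Q + 2,
    fun a => ?_⟩
  have h₁ := (runs_dup_word a).seq ((hR a).1.frame (word a))
  have hP₂ := (hP a).2
  have hQ₂ := (hQ a).2
  dsimp only
  cases hca : c a
  · rw [hca] at h₁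
    refine ⟨(h₁.seq (runs_test_neg (p := p) (by simp) (hQ a).1)).mono ?_, ?_⟩
    · simp; omega
    · simp; omega
  · rw [hca] at h₁
    refine ⟨(h₁.seq (runs_test_pos (q := q) (hP a).1)).mono ?_, ?_⟩
    · simp; omega
    · simp; omega

/-- Case distinction on a list. -/
theorem listCase {F : α → List β → γ} {f : α → γ} {g : α × β × List β → γ} {l : α → List β}
    (hl : PolyTime l) (hf : PolyTime f) (hg : PolyTime g) (h0 : ∀ a, F a [] = f a)
    (h1 : ∀ a b t, F a (b :: t) = g (a, b, t)) : PolyTime fun a => F a (l a) := by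
  obtain ⟨r, R, hR⟩ := hl
  obtain ⟨p, P, hP⟩ := hf
  obtain ⟨q, Q, hQ⟩ := hg
  -- The test removes the node of a nonempty `l a`. Pushing it back, exchanging the list with `a`
  -- and pushing another node yields the tree of `(a, b :: t)`, which is also that of `(a, b, t)`.
  refine ⟨seq (seq dup r) (test .node (seq (put .node) (seq swap (seq (put .node) q))) p),
    45 * Polynomial.X + 16 * R + P + Q.comp (Polynomial.X + R + 1) + 20, fun a => ?_⟩
  have h₁ := (runs_dup_word a).seq ((hR a).1.frame (word a))
  have hP₂ := (hP a).2
  have hR₂ := (hR a).2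
  dsimp only
  cases hla : l a with
  | nil =>
    rw [hla] at h₁
    rw [h0]
    refine ⟨(h₁.seq (runs_test_neg (by simp) (hP a).1)).mono ?_, ?_⟩
    · simp; omega
    · simp; omega
  | cons b t =>
    rw [hla] at h₁ hR₂
    rw [h1]
    have hQ₂ := (hQ (a, b, t)).2
    have hmono := Q.eval_nat_mono (m := size (a, b, t)) (n := size a + R.eval (size a) + 1)
      (by simp only [size_pair, size_cons] at *; omega)
    have h₂ := (runs_put (x := word b ++ word t ++ word a) .node).seq
      ((runs_swap_word (b :: t) a).seq ((runs_put .node).seq (hQ (a, b, t)).1))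
    refine ⟨(h₁.seq (runs_test_pos (q := p) h₂)).mono ?_, ?_⟩
    · simp [-size_pair, -size_cons]
      omega
    · simp [-size_pair, -size_cons]
      omega

/-- Between rounds the accumulator waits, reversed, on the left stack and the top symbol of the list
is in the memory. A node there announces an element `b`; the accumulator is put back above `b` and a
node forms the pair on which `p` runs. Time and size are assumed only along prefixes of `l`, so
bounds on the accumulators that really occur suffice. A round costs `3M + 2` and `7M + 2` for the
two moves, `T` for `p`, and 3 more. -/
theorem exec_fold_loop {f : γ → β → γ} {p : TreeProg} {T M : ℕ} {w : List TreeSym} :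
    ∀ (l : List β) (acc : γ),
    (∀ l₁ b, l₁ ++ [b] <+: l → Runs p T (.node :: (word (l₁.foldl f acc) ++ word b))
      (word (f (l₁.foldl f acc) b))) →
    (∀ l₁, l₁ <+: l → size (l₁.foldl f acc) ≤ M) →
    ∃ v', Exec (loop (holds .node) (seq leftToMain (seq (seq (put .node) p)
        (seq takeLeft popMain)))) (word l).head?
      (stk [] [] [] ((word l).tail ++ w) (word acc).reverse [] []) v'
      (stk [] [] [] w (word (l.foldl f acc)).reverse [] []) (l.length * (T + 10 * M + 7) + 1)
  | [], acc, _, _ => ⟨_, (Exec.loop_neg rfl).mono (by simp)⟩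
  | b :: l, acc, hp, hM => by
    obtain ⟨v', ih⟩ := exec_fold_loop l (f acc b) (w := w)
      (fun l₁ b' h => by
        obtain ⟨l₂, rfl⟩ := h
        exact hp (b :: l₁) b' ⟨l₂, by simp⟩)
      (fun l₁ h => hM (b :: l₁) (by obtain ⟨l₂, rfl⟩ := h; exact ⟨l₂, by simp⟩))
    refine ⟨v', ?_⟩
    have h₁ := hM [] List.nil_prefix
    have h₂ := hM [b] ⟨l, rfl⟩
    have hb := hp [] b ⟨l, rfl⟩
    simp only [List.foldl_nil, List.foldl_cons] at h₁ h₂ hb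
    obtain ⟨v₁, e₁⟩ := (runs_put (x := word acc ++ word b) .node |>.seq hb) none (word l ++ w)
    have e₀ := exec_leftToMain (v := some .node) (i := []) (o := []) (u := [])
      (d := word b ++ (word l ++ w)) (a := (word acc).reverse) (b := []) (c := [])
    have e₂ := exec_takeLeft (v := v₁) (i := []) (o := []) (u := []) (d := word l ++ w) (a := [])
      (b := []) (TreeEnc.enc (f acc b))
    have e₃ := exec_popMain (v := none) (i := []) (o := []) (u := []) (d := word l ++ w)
      (a := (word (f acc b)).reverse) (b := []) (c := [])
    have hw : (word l ++ w).head? = (word l).head? ∧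
        (word l ++ w).tail = (word l).tail ++ w := by
      cases l <;> simp [word_nil, word_cons]
    rw [hw.1, hw.2] at e₃
    rw [List.reverse_reverse] at e₀
    rw [List.append_assoc] at e₁
    rw [List.append_nil] at e₂
    have h := Exec.loop_pos (b := holds .node) rfl (e₀.seq (e₁.seq (e₂.seq e₃))) ih
    simp only [word_cons, List.head?_cons, List.tail_cons, List.append_assoc, List.foldl_cons]
    refine h.mono ?_
    have s₁ : (word acc).length = size acc := rfl
    have s₂ : (TreeEnc.enc (f acc b)).ser.length = size (f acc b) := rfl
    rw [List.length_reverse, s₁, s₂, List.length_cons, add_mul]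
    omega

/-- Left folds with accumulators of polynomially bounded size. -/
theorem foldl {f : γ → β → γ} {g : α → γ} {l : α → List β}
    (hf : PolyTime fun x : γ × β => f x.1 x.2) (hg : PolyTime g) (hl : PolyTime l)
    (B : Polynomial ℕ) (hB : ∀ a l₁, l₁ <+: l a → size (l₁.foldl f (g a)) ≤ B.eval (size a)) :
    PolyTime fun a => (l a).foldl f (g a) := by
  obtain ⟨p, P, hP⟩ := hf
  obtain ⟨q, Q, hQ⟩ := hg
  obtain ⟨r, R, hR⟩ := hl
  refine ⟨seq (seq dup (seq r (seq swap q))) (seq (seq takeLeft popMain) (seq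
    (loop (holds .node) (seq leftToMain (seq (seq (put .node) p) (seq takeLeft popMain))))
    leftToMain)), 45 * Polynomial.X + 16 * R + Q + 10 * B + 20 +
    R * (P.comp (B + R + 1) + 10 * B + 7), fun a => ⟨fun v w => ?_, ?_⟩⟩
  · have hB₁ := hB a [] List.nil_prefix
    have hB₂ := hB a (l a) List.prefix_rfl
    have hR₂ := (hR a).2
    have hQ₂ := (hQ a).2
    rw [List.foldl_nil] at hB₁
    obtain ⟨v₁, e₁⟩ := ((runs_dup_word a).seq (((hR a).1.frame (word a)).seq
      ((runs_swap_word (l a) a).seq ((hQ a).1.frame (word (l a)))))) v w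
    -- In each round `p` reads a pair of an accumulator, bounded by `B`, and an element of the list,
    -- bounded by `R`.
    obtain ⟨v₂, e₂⟩ := exec_fold_loop (f := f) (p := p) (w := w)
      (T := P.eval (B.eval (size a) + R.eval (size a) + 1)) (M := B.eval (size a)) (l a) (g a)
      (fun l₁ b h => by
        refine (hP (l₁.foldl f (g a), b)).1.mono (P.eval_nat_mono ?_)
        have h₁ := hB a l₁ ((List.prefix_append _ _).trans h)
        have h₂ := size_le_of_mem (h.subset (show b ∈ l₁ ++ [b] by simp))
        rw [size_pair]
        omega)
      (hB a)
    have e₃ := exec_takeLeft (v := v₁) (i := []) (o := []) (u := []) (d := word (l a) ++ w)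
      (a := []) (b := []) (TreeEnc.enc (g a))
    have e₄ := exec_popMain (v := none) (i := []) (o := []) (u := []) (d := word (l a) ++ w)
      (a := (word (g a)).reverse) (b := []) (c := [])
    have hw : (word (l a) ++ w).head? = (word (l a)).head? ∧
        (word (l a) ++ w).tail = (word (l a)).tail ++ w := by
      cases l a <;> simp [word_nil, word_cons]
    rw [hw.1, hw.2] at e₄
    rw [List.append_assoc] at e₁
    rw [List.append_nil] at e₃
    have e₅ := exec_leftToMain (v := v₂) (i := []) (o := []) (u := [])
      (d := w) (a := (word ((l a).foldl f (g a))).reverse) (b := []) (c := [])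
    rw [List.reverse_reverse] at e₅
    refine ⟨_, (e₁.seq ((e₃.seq e₄).seq (e₂.seq e₅))).mono ?_⟩
    have s₁ : (word ((l a).foldl f (g a))).length = size ((l a).foldl f (g a)) := rfl
    have s₂ : (TreeEnc.enc (g a)).ser.length = size (g a) := rfl
    have hlen := Nat.mul_le_mul_right
      (P.eval (B.eval (size a) + R.eval (size a) + 1) + 10 * B.eval (size a) + 7)
      ((length_le_size (l a)).trans hR₂)
    rw [List.length_reverse, s₁, s₂]
    simp
    omega
  · have := hB a (l a) List.prefix_rfl
    simp
    omega

theorem reverse {l : α → List β} (hl : PolyTime l) : PolyTime fun a => (l a).reverse := by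
  have h : PolyTime fun l : List β => l.foldl (fun t b => b :: t) [] := by
    refine foldl (cons snd fst) nil PolyTime.id Polynomial.X fun l l₁ h => ?_
    have e : l₁.foldl (fun t b => b :: t) [] = l₁.reverse := by simp
    rw [e, size_reverse, Polynomial.eval_X]
    exact size_le_of_sublist h.sublist
  have e : (fun l : List β => l.foldl (fun t b => b :: t) []) = List.reverse := by
    funext l; simp
  rw [e] at h
  exact h.comp hl

/-- Structural recursion on a list, with values of polynomially bounded size. -/
theorem listRec {F : α → List β → γ} {f : α → γ} {g : α × β × List β × γ → γ}
    {l : α → List β} (hl : PolyTime l) (hf : PolyTime f) (hg : PolyTime g)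
    (h0 : ∀ a, F a [] = f a) (h1 : ∀ a b t, F a (b :: t) = g (a, b, t, F a t))
    (B : Polynomial ℕ) (hB : ∀ a t, t <:+ l a → size (F a t) ≤ B.eval (size a + size (l a))) :
    PolyTime fun a => F a (l a) := by
  obtain ⟨R, hR⟩ := hl.exists_size_le
  -- Recursion becomes a left fold over the reversed list; the accumulator holds the parameter, the
  -- suffix treated so far and the value on this suffix.
  have e : ∀ (a : α) (t : List β), t.reverse.foldl (fun (x : α × List β × γ) b =>
      (x.1, b :: x.2.1, g (x.1, b, x.2.1, x.2.2))) (a, [], f a) = (a, t, F a t) := by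
    intro a t
    induction t with
    | nil => simp [h0]
    | cons b t ih => simp [ih, h1]
  have h : PolyTime fun a => (l a).reverse.foldl (fun (x : α × List β × γ) b =>
      (x.1, b :: x.2.1, g (x.1, b, x.2.1, x.2.2))) (a, [], f a) := by
    refine foldl (β := β) (γ := α × List β × γ)
      (f := fun x b => (x.1, b :: x.2.1, g (x.1, b, x.2.1, x.2.2))) ?_
      (PolyTime.id.pair (nil.pair hf)) hl.reverse (Polynomial.X + R + B.comp (Polynomial.X + R) + 2) ?_
    · have h₁ : PolyTime fun x : (α × List β × γ) × β => x.1.1 := fst.comp fst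
      have h₂ : PolyTime fun x : (α × List β × γ) × β => x.1.2.1 := fst.comp (snd.comp fst)
      have h₃ : PolyTime fun x : (α × List β × γ) × β => x.1.2.2 := snd.comp (snd.comp fst)
      exact h₁.pair ((cons snd h₂).pair (hg.comp (h₁.pair (snd.pair (h₂.pair h₃)))))
    · intro a l₁ hl₁
      have hs : l₁.reverse <:+ l a := by
        rw [← List.reverse_reverse (l a)]
        exact List.reverse_suffix.2 hl₁
      have := e a l₁.reverse
      rw [List.reverse_reverse] at this
      rw [this]
      have h₁ := hB a _ hs
      have h₂ := size_le_of_sublist hs.sublist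
      have h₃ := hR a
      have h₄ := B.eval_nat_mono (Nat.add_le_add_left h₃ (size a))
      simp
      simp at h₂
      omega
  have h' := snd.comp (snd.comp h)
  simpa only [e] using h'

end PolyTime

/-! ### Conversion between input and output words and trees. -/

namespace TreeProg

/-- Load the input word as a list to the main stack. -/
def readInput : TreeProg :=
  .seq (.seq (.pop .inp fun _ s => s.map .leaf)
      (loop holdsAny (.seq (.push .left fun v => v.getD .node) (.pop .inp fun _ s => s.map .leaf))))
    (.seq (put (.leaf .bar)) (.seq (.pop .left fun _ s => s)
      (loop holdsAny (.seq (.seq pushMain (put .node)) (.pop .left fun _ s => s)))))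

theorem exec_popInp {v : Option TreeSym} {i : List EncSym} {a : List TreeSym} :
    Exec (.pop .inp fun _ s => s.map .leaf) v (stk i [] [] [] a [] []) (i.head?.map .leaf)
      (stk i.tail [] [] [] a [] []) 1 := by
  have h := Exec.pop (Γ := TreeStack.Alphabet) .inp (fun _ s => s.map .leaf) v
    (stk i [] [] [] a [] [])
  rw [update_inp] at h
  exact h

theorem exec_inp_loop : ∀ {i : List EncSym} {a : List TreeSym},
    Exec (loop holdsAny (.seq (.push .left fun v => v.getD .node)
      (.pop .inp fun _ s => s.map .leaf))) (i.head?.map .leaf) (stk i.tail [] [] [] a [] []) none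
      (stk [] [] [] [] ((i.map .leaf).reverse ++ a) [] []) (3 * i.length + 1)
  | [], a => Exec.loop_neg rfl
  | s :: i, a => by
    have h := Exec.loop_pos (b := holdsAny) rfl
      ((exec_pushLeft (v := some (.leaf s)) (a := a)).seq exec_popInp)
      (exec_inp_loop (i := i) (a := .leaf s :: a))
    simpa using h.mono (t' := 3 * (s :: i).length + 1) (by simp only [List.length_cons]; omega)

theorem exec_put {s : TreeSym} {v : Option TreeSym} {i o u d a b c} :
    Exec (put s) v (stk i o u d a b c) v (stk i o u (s :: d) a b c) 1 := by
  have h := Exec.push (Γ := TreeStack.Alphabet) .main (fun _ => s) v (stk i o u d a b c)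
  rw [update_main] at h
  exact h

/-- Pushing the leaf `s` and then a node turns `word l'` into `word (s :: l')`. The left stack
delivers the input back to front, as building a list from its end requires. -/
theorem exec_list_loop : ∀ {l l' : List EncSym},
    Exec (loop holdsAny (.seq (.seq pushMain (put .node)) (.pop .left fun _ s => s)))
      (l.map TreeSym.leaf).head? (stk [] [] [] (word l') (l.map TreeSym.leaf).tail [] []) none
      (stk [] [] [] (word (l.reverse ++ l')) [] [] []) (4 * l.length + 1)
  | [], l' => Exec.loop_neg rfl
  | s :: l, l' => by
    have h := Exec.loop_pos (b := holdsAny) rfl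
      (((exec_pushMain (v := some (.leaf s)) (d := word l')).seq exec_put).seq exec_popLeft)
      (exec_list_loop (l := l) (l' := s :: l'))
    simpa using h.mono (t' := 4 * (s :: l).length + 1) (by simp only [List.length_cons]; omega)

theorem exec_readInput (l : List EncSym) : Exec readInput none (stk l [] [] [] [] [] []) none
    (stk [] [] [] (word l) [] [] []) (7 * l.length + 5) := by
  have h₁ := exec_popInp (v := none) (i := l) (a := [])
  have h₂ := exec_inp_loop (i := l) (a := [])
  have h₃ := exec_list_loop (l := l.reverse) (l' := [])
  rw [List.append_nil, ← List.map_reverse] at h₂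
  rw [List.reverse_reverse, List.append_nil] at h₃
  exact ((h₁.seq h₂).seq (exec_put.seq (exec_popLeft.seq h₃))).mono (by simp; omega)

/-- The label of a leaf in the memory. -/
def leafSym : Option TreeSym → EncSym
  | some (.leaf s) => s
  | _ => .bar

/-- Write the list on the main stack to the output stack. -/
def writeWord : TreeProg :=
  .seq (.seq popMain (loop (holds .node)
      (.seq popMain (.seq (.push .left fun v => v.getD .node) popMain))))
    (.seq (.pop .left fun _ s => s) (loop holdsAny (.seq
      (.push .outWord leafSym)
      (.pop .left fun _ s => s))))

theorem exec_unlist_loop : ∀ {l : List EncSym} {a : List TreeSym},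
    Exec (loop (holds .node)
      (.seq popMain (.seq (.push .left fun v => v.getD .node) popMain))) (word l).head?
      (stk [] [] [] (word l).tail a [] []) (some (.leaf .bar))
      (stk [] [] [] [] ((l.map TreeSym.leaf).reverse ++ a) [] []) (4 * l.length + 1)
  | [], a => Exec.loop_neg rfl
  | s :: l, a => by
    have h := Exec.loop_pos (b := holds .node) rfl
      ((exec_popMain (v := some .node) (d := .leaf s :: word l) (a := a)).seq
        (exec_pushLeft.seq exec_popMain)) (exec_unlist_loop (l := l) (a := .leaf s :: a))
    simpa [word_cons, word_sym] using h.mono (t' := 4 * (s :: l).length + 1) (by simp only [List.length_cons]; omega)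

theorem exec_out_loop : ∀ {l o : List EncSym},
    Exec (loop holdsAny (.seq
      (.push .outWord leafSym)
      (.pop .left fun _ s => s))) (l.map TreeSym.leaf).head?
      (stk [] o [] [] (l.map TreeSym.leaf).tail [] []) none
      (stk [] (l.reverse ++ o) [] [] [] [] []) (3 * l.length + 1)
  | [], o => Exec.loop_neg rfl
  | s :: l, o => by
    have h₁ := Exec.push (Γ := TreeStack.Alphabet) .outWord
      leafSym (some (.leaf s))
      (stk [] o [] [] (l.map TreeSym.leaf) [] [])
    rw [update_outWord] at h₁
    have h := Exec.loop_pos (b := holdsAny) rfl (h₁.seq exec_popLeft)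
      (exec_out_loop (l := l) (o := s :: o))
    simpa using h.mono (t' := 3 * (s :: l).length + 1) (by simp only [List.length_cons]; omega)

theorem exec_writeWord (l : List EncSym) (v : Option TreeSym) :
    Exec writeWord v (stk [] [] [] (word l) [] [] []) none (stk [] l [] [] [] [] [])
      (7 * l.length + 4) := by
  have h₁ := exec_popMain (v := v) (i := []) (o := []) (u := []) (d := word l) (a := []) (b := [])
    (c := [])
  have h₂ := exec_unlist_loop (l := l) (a := [])
  have h₃ := exec_out_loop (l := l.reverse) (o := [])
  rw [List.append_nil, ← List.map_reverse] at h₂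
  rw [List.reverse_reverse, List.append_nil] at h₃
  exact ((h₁.seq h₂).seq (exec_popLeft.seq h₃)).mono (by simp; omega)

/-- Write the truth value on the main stack to the output stack. -/
def writeBool : TreeProg :=
  .seq popMain (.seq (.push .outBit fun v => v == some (.leaf (.bit true))) (load fun _ => none))

/-- The final `load` restores the memory `none`, since `polyTimeComputable` asks for the initial
memory at the end. -/
theorem exec_writeBool (t : Bool) (v : Option TreeSym) :
    Exec writeBool v (stk [] [] [] (word t) [] [] []) none (stk [] [] [t] [] [] [] []) 3 := by
  have h₁ := exec_popMain (v := v) (i := []) (o := []) (u := []) (d := word t) (a := []) (b := [])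
    (c := [])
  have h₂ := Exec.push (Γ := TreeStack.Alphabet) .outBit
      (fun v => v == some (.leaf (.bit true))) (word t).head?
      (stk [] [] [] (word t).tail [] [] [])
  rw [update_outBit] at h₂
  have e : ((word t).head? == some (.leaf (.bit true))) = t := by cases t <;> rfl
  rw [e] at h₂
  exact h₁.seq (h₂.seq (Exec.load _ _ _))

end TreeProg

theorem size_symList (l : List EncSym) : size l = 2 * l.length + 1 := by
  induction l with
  | nil => rfl
  | cons s l ih => simp only [size_cons, size_sym, List.length_cons, ih]; omega

/-! ### Transfer to Turing machines; Boolean and list operations. -/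

namespace PolyTime

/-- Polynomial time functions on words are computable in polynomial time. -/
theorem polyTimeComputable_word {g : List EncSym → List EncSym} (hg : PolyTime g) {α β : Type}
    (ea : α → List EncSym) (eb : β → List EncSym) (f : α → β) (h : ∀ a, g (ea a) = eb (f a)) :
    PolyTimeComputable ea eb f := by
  obtain ⟨p, P, hP⟩ := hg
  refine StackProg.polyTimeComputable ea eb f (seq readInput (seq p writeWord))
    TreeStack.inp TreeStack.outWord none (Equiv.refl _) (Equiv.refl _)
    (7 * Polynomial.X + 10 + 8 * P.comp (2 * Polynomial.X + 1)) fun a => ?_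
  obtain ⟨v, hv⟩ := (hP (ea a)).1 none []
  rw [List.append_nil, List.append_nil] at hv
  have hs := (hP (ea a)).2
  have e : ∀ k, (fun _ => [] : ∀ k, List (TreeStack.Alphabet k)) k = stk [] [] [] [] [] [] [] k := by
    intro k; cases k <;> rfl
  rw [funext e, update_inp, update_outWord]
  have key := (exec_readInput (ea a)).seq (hv.seq (exec_writeWord (g (ea a)) v))
  rw [h] at key hs
  rw [size_symList, size_symList] at hs
  simp only [Equiv.refl_symm, Equiv.coe_refl, List.map_id]
  refine key.mono ?_
  rw [size_symList]
  simp
  omega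

/-- Predicates on words that are decidable in polynomial time. -/
theorem polyTimeComputable_bool {g : List EncSym → Bool} (hg : PolyTime g) {α : Type}
    (ea : α → List EncSym) (f : α → Bool) (h : ∀ a, g (ea a) = f a) :
    PolyTimeComputable ea Computability.encodeBool f := by
  obtain ⟨p, P, hP⟩ := hg
  refine StackProg.polyTimeComputable ea _ f (seq readInput (seq p writeBool))
    TreeStack.inp TreeStack.outBit none (Equiv.refl _) (Equiv.refl _)
    (7 * Polynomial.X + 10 + P.comp (2 * Polynomial.X + 1)) fun a => ?_
  obtain ⟨v, hv⟩ := (hP (ea a)).1 none []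
  rw [List.append_nil, List.append_nil] at hv
  have e : ∀ k, (fun _ => [] : ∀ k, List (TreeStack.Alphabet k)) k = stk [] [] [] [] [] [] [] k := by
    intro k; cases k <;> rfl
  rw [funext e, update_inp, update_outBit]
  have key := (exec_readInput (ea a)).seq (hv.seq (exec_writeBool (g (ea a)) v))
  rw [h] at key
  simp only [Equiv.refl_symm, Equiv.coe_refl, List.map_id]
  refine key.mono ?_
  rw [size_symList]
  simp
  omega

theorem and {f g : α → Bool} (hf : PolyTime f) (hg : PolyTime g) :
    PolyTime fun a => f a && g a := by
  have h := cond hf hg (const_bool false)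
  have e : (fun a => bif f a then g a else false) = fun a => f a && g a := by
    funext a; cases f a <;> rfl
  exact e ▸ h

theorem not {f : α → Bool} (hf : PolyTime f) : PolyTime fun a => !f a := by
  have h := cond hf (const_bool false) (const_bool true)
  have e : (fun a => bif f a then false else true) = fun a => !f a := by
    funext a; cases f a <;> rfl
  exact e ▸ h

theorem or {f g : α → Bool} (hf : PolyTime f) (hg : PolyTime g) :
    PolyTime fun a => f a || g a := by
  have h := cond hf (const_bool true) hg
  have e : (fun a => bif f a then true else g a) = fun a => f a || g a := by
    funext a; cases f a <;> rfl
  exact e ▸ h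

theorem xor {f g : α → Bool} (hf : PolyTime f) (hg : PolyTime g) :
    PolyTime fun a => f a ^^ g a := by
  have h := cond hf hg.not hg
  have e : (fun a => bif f a then !g a else g a) = fun a => f a ^^ g a := by
    funext a; cases f a <;> cases g a <;> rfl
  exact e ▸ h

theorem tail {l : α → List β} (hl : PolyTime l) : PolyTime fun a => (l a).tail :=
  listCase (F := fun _ l => l.tail) hl nil (snd.comp snd) (fun _ => rfl) (fun _ _ _ => rfl)

theorem headD {l : α → List β} {f : α → β} (hl : PolyTime l) (hf : PolyTime f) :
    PolyTime fun a => (l a).headD (f a) :=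
  listCase (F := fun a l => l.headD (f a)) hl hf (fst.comp snd) (fun _ => rfl) (fun _ _ _ => rfl)

theorem append {l l' : α → List β} (hl : PolyTime l) (hl' : PolyTime l') :
    PolyTime fun a => l a ++ l' a := by
  obtain ⟨P, hP⟩ := hl'.exists_size_le
  refine listRec (F := fun a l => l ++ l' a) (g := fun x => x.2.1 :: x.2.2.2) hl hl'
    (cons (fst.comp snd) (snd.comp (snd.comp snd))) (fun _ => rfl) (fun _ _ _ => rfl)
    (Polynomial.X + P) fun a t ht => ?_
  have h₁ := size_append t (l' a)
  have h₂ := hP a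
  have h₃ := size_le_of_sublist ht.sublist
  have h₄ := P.eval_nat_mono (Nat.le_add_right (size a) (size (l a)))
  simp
  omega

theorem map {f : α × β → γ} {l : α → List β} (hf : PolyTime f) (hl : PolyTime l) :
    PolyTime fun a => (l a).map fun b => f (a, b) := by
  obtain ⟨P, hP⟩ := hf.exists_size_le
  refine listRec (F := fun a l => l.map fun b => f (a, b))
    (g := fun x => f (x.1, x.2.1) :: x.2.2.2) hl nil
    (cons (hf.comp (fst.pair (fst.comp snd))) (snd.comp (snd.comp snd)))
    (fun _ => rfl) (fun _ _ _ => rfl)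
    (Polynomial.X * (P.comp (Polynomial.X + 1) + 1) + 1) fun a t ht => ?_
  have h := size_list_le (l := t.map fun b => f (a, b))
    (n := P.eval (size a + size (l a) + 1)) (by
      intro c hc
      obtain ⟨b, hb, rfl⟩ := List.mem_map.1 hc
      refine (hP _).trans (P.eval_nat_mono ?_)
      have := size_le_of_mem (ht.subset hb)
      rw [size_pair]
      omega)
  refine h.trans ?_
  have h₂ := length_le_size t
  have h₃ := size_le_of_sublist ht.sublist
  simp only [List.length_map, Polynomial.eval_add, Polynomial.eval_mul, Polynomial.eval_X,
    Polynomial.eval_comp, Polynomial.eval_one]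
  gcongr
  omega

theorem size_flatMap_le {ι : Type} {f : ι → List γ} {l : List ι} {n : ℕ} (h : ∀ a ∈ l, size (f a) ≤ n) :
    size (l.flatMap f) ≤ l.length * n + 1 := by
  induction l with
  | nil => simp
  | cons a l ih =>
    have h₁ := h a (by simp)
    have h₂ := ih fun b hb => h b (by simp [hb])
    have h₃ := size_append (f a) (l.flatMap f)
    simp only [List.flatMap_cons, List.length_cons, add_mul]
    omega

theorem flatMap {f : α × β → List γ} {l : α → List β} (hf : PolyTime f) (hl : PolyTime l) :
    PolyTime fun a => (l a).flatMap fun b => f (a, b) := by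
  obtain ⟨P, hP⟩ := hf.exists_size_le
  refine listRec (F := fun a l => l.flatMap fun b => f (a, b))
    (g := fun x => f (x.1, x.2.1) ++ x.2.2.2) hl nil
    (append (hf.comp (fst.pair (fst.comp snd))) (snd.comp (snd.comp snd)))
    (fun _ => rfl) (fun _ _ _ => rfl)
    (Polynomial.X * P.comp (Polynomial.X + 1) + 1) fun a t ht => ?_
  have h := size_flatMap_le (f := fun b => f (a, b)) (l := t)
    (n := P.eval (size a + size (l a) + 1)) (by
      intro b hb
      refine (hP _).trans (P.eval_nat_mono ?_)
      have := size_le_of_mem (ht.subset hb)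
      rw [size_pair]
      omega)
  refine h.trans ?_
  have h₂ := length_le_size t
  have h₃ := size_le_of_sublist ht.sublist
  simp only [Polynomial.eval_add, Polynomial.eval_mul, Polynomial.eval_X,
    Polynomial.eval_comp, Polynomial.eval_one]
  gcongr
  omega

theorem all {f : α × β → Bool} {l : α → List β} (hf : PolyTime f) (hl : PolyTime l) :
    PolyTime fun a => (l a).all fun b => f (a, b) :=
  listRec (F := fun a l => l.all fun b => f (a, b)) (g := fun x => f (x.1, x.2.1) && x.2.2.2) hl
    (const_bool true) ((hf.comp (fst.pair (fst.comp snd))).and (snd.comp (snd.comp snd)))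
    (fun _ => rfl) (fun _ _ _ => rfl) 1 fun _ _ _ => by simp

theorem filter {f : α × β → Bool} {l : α → List β} (hf : PolyTime f) (hl : PolyTime l) :
    PolyTime fun a => (l a).filter fun b => f (a, b) := by
  refine listRec (F := fun a l => l.filter fun b => f (a, b))
    (g := fun x => bif f (x.1, x.2.1) then x.2.1 :: x.2.2.2 else x.2.2.2) hl nil
    (cond (hf.comp (fst.pair (fst.comp snd))) (cons (fst.comp snd) (snd.comp (snd.comp snd)))
      (snd.comp (snd.comp snd))) (fun _ => rfl) (fun a b t => ?_) Polynomial.X fun a t ht => ?_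
  · cases h : f (a, b) <;> simp [h]
  · have h₁ := size_le_of_sublist ht.sublist
    have h₂ := size_le_of_sublist (List.filter_sublist (p := fun b => f (a, b)) (l := t))
    simp
    omega

end PolyTime

/-! ### Binary arithmetic, least significant digit first, with superfluous zeros allowed. -/

namespace BinWord

/-- The number with the given binary digits. -/
def val : List Bool → ℕ
  | [] => 0
  | b :: x => b.toNat + 2 * val x

@[simp] theorem val_nil : val [] = 0 := rfl

@[simp] theorem val_cons (b : Bool) (x : List Bool) : val (b :: x) = b.toNat + 2 * val x := rfl

theorem size_eq (x : List Bool) : size x = 2 * x.length + 1 := by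
  induction x with
  | nil => rfl
  | cons s l ih => simp only [size_cons, size_bool, List.length_cons, ih]; omega

/-- Increment. -/
def inc : List Bool → List Bool
  | [] => [true]
  | false :: x => true :: x
  | true :: x => false :: inc x

@[simp] theorem val_inc : ∀ x, val (inc x) = val x + 1
  | [] => rfl
  | false :: x => by simp [inc, add_comm]
  | true :: x => by simp [inc, val_inc x]; omega

/-- An increment lengthens the word only if all digits are 1. Unlike `length_inc_le`, this bound
does not accumulate over the repeated increments in `addDigits`. -/
theorem length_inc_le_of_val : ∀ (x : List Bool) (n : ℕ), x.length ≤ n → val x + 1 < 2 ^ n →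
    (inc x).length ≤ n
  | [], n, _, h => by
    cases n
    · simp at h
    · simp [inc]
  | false :: x, n, hn, h => by simpa [inc] using hn
  | true :: x, 0, hn, h => by simp at hn
  | true :: x, n + 1, hn, h => by
    have := length_inc_le_of_val x n (by simpa using hn)
      (by rw [pow_succ] at h; simp at h; omega)
    simpa [inc] using this

theorem length_inc_le (x : List Bool) : (inc x).length ≤ x.length + 1 := by
  induction x with
  | nil => simp [inc]
  | cons b x ih => cases b <;> simp [inc]; omega

theorem polyTime_inc {f : α → List Bool} (hf : PolyTime f) : PolyTime fun a => inc (f a) := by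
  refine PolyTime.listRec (F := fun _ l => inc l) (f := fun _ => [true])
    (g := fun x => bif x.2.1 then false :: x.2.2.2 else true :: x.2.2.1) hf
    (.cons (.const_bool _) .nil) (.cond (.comp .fst .snd)
      (.cons (.const_bool _) (.comp .snd (.comp .snd .snd)))
      (.cons (.const_bool _) (.comp .fst (.comp .snd .snd))))
    (fun _ => rfl) (fun a b t => by cases b <;> rfl) (Polynomial.X + 2) fun a t ht => ?_
  have h₁ := size_le_of_sublist ht.sublist
  have h₂ := length_inc_le t
  simp only [size_eq, Polynomial.eval_add, Polynomial.eval_X, Polynomial.eval_ofNat] at *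
  omega

/-- The pairs of corresponding digits of two numbers. -/
def digits : List Bool → List Bool → List (Bool × Bool)
  | [], y => y.map fun b => (false, b)
  | b :: x, y => (b, y.headD false) :: digits x y.tail

theorem val_digits_fst : ∀ x y, val ((digits x y).map Prod.fst) = val x
  | [], y => by
    induction y with
    | nil => rfl
    | cons b y ih => simpa [digits] using ih
  | b :: x, y => by simp [digits, val_digits_fst x]

theorem val_digits_snd : ∀ x y, val ((digits x y).map Prod.snd) = val y
  | [], y => by simp [digits, Function.comp_def]
  | b :: x, [] => by simp [digits, val_digits_snd x]
  | b :: x, c :: y => by simp [digits, val_digits_snd x]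

theorem length_digits : ∀ x y, (digits x y).length = max x.length y.length
  | [], y => by simp [digits]
  | b :: x, y => by simp [digits, length_digits x]; cases y <;> simp

/-- Move one pair of corresponding digits from the two numbers to the output. -/
def digitsStep (s : List Bool × List (Bool × Bool)) (b : Bool) :
    List Bool × List (Bool × Bool) :=
  (s.1.tail, (b, s.1.headD false) :: s.2)

/-- The recursion of `digits` consumes both lists, whereas `PolyTime.listRec` keeps its parameter
fixed; a fold over `x` whose state holds the unread part of `y` does the same work. -/
theorem digits_eq_foldl : ∀ x y z, (x.foldl digitsStep (y, z)).2.reverse ++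
    (x.foldl digitsStep (y, z)).1.map (fun b => (false, b)) = z.reverse ++ digits x y
  | [], y, z => rfl
  | b :: x, y, z => by simp [digits, digitsStep, digits_eq_foldl x]

theorem size_digits (z : List (Bool × Bool)) : size z = 4 * z.length + 1 := by
  induction z with
  | nil => rfl
  | cons s l ih =>
    obtain ⟨a, b⟩ := s
    simp only [size_cons, size_pair, size_bool, List.length_cons, ih]; omega

theorem length_foldl_digitsStep : ∀ (x y : List Bool) (z : List (Bool × Bool)),
    (x.foldl digitsStep (y, z)).1.length ≤ y.length ∧
    (x.foldl digitsStep (y, z)).2.length = x.length + z.length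
  | [], y, z => by simp
  | b :: x, y, z => by
    have := length_foldl_digitsStep x y.tail ((b, y.headD false) :: z)
    simp [digitsStep] at *
    omega

theorem polyTime_digits {f g : α → List Bool} (hf : PolyTime f) (hg : PolyTime g) :
    PolyTime fun a => digits (f a) (g a) := by
  obtain ⟨P, hP⟩ := hf.exists_size_le
  obtain ⟨Q, hQ⟩ := hg.exists_size_le
  have h : PolyTime fun a => (f a).foldl digitsStep (g a, []) := by
    refine .foldl (f := digitsStep) (.pair (.tail (.comp .fst .fst)) (.cons
      (.pair .snd (.headD (.comp .fst .fst) (.const_bool _))) (.comp .snd .fst)))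
      (.pair hg .nil) hf (4 * P + Q + 2) fun a l hl => ?_
    have h₁ := length_foldl_digitsStep l (g a) []
    have h₂ := hl.length_le
    have h₃ := hP a
    have h₄ := hQ a
    generalize l.foldl digitsStep (g a, []) = s at *
    obtain ⟨s, t⟩ := s
    simp only [size_eq, size_digits, size_pair, Polynomial.eval_add, Polynomial.eval_mul,
      Polynomial.eval_ofNat, List.length_nil] at *
    omega
  have h' := ((PolyTime.snd.comp h).reverse).append
    (PolyTime.map (f := fun x : α × Bool => (false, x.2)) ((PolyTime.const_bool _).pair .snd) (PolyTime.fst.comp h))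
  simpa only [digits_eq_foldl, List.reverse_nil, List.nil_append] using h'

/-- Propagation of carries. -/
def addDigits : List (Bool × Bool) → List Bool
  | [] => []
  | s :: z => (s.1 ^^ s.2) :: bif s.1 && s.2 then inc (addDigits z) else addDigits z

/-- A carry is an increment of the sum of the higher digits. -/
theorem val_addDigits : ∀ z, val (addDigits z) = val (z.map Prod.fst) + val (z.map Prod.snd)
  | [] => rfl
  | (a, b) :: z => by
    cases a <;> cases b <;> simp [addDigits, val_addDigits z] <;> omega

theorem val_lt (x : List Bool) : val x + 1 ≤ 2 ^ x.length := by
  induction x with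
  | nil => simp
  | cons b x ih =>
    rw [List.length_cons, pow_succ]
    cases b <;> simp <;> omega

/-- Two numbers of `n` digits have a sum that stays below `2 ^ (n + 1)` even when increased by one,
so the carries add at most one digit in total. -/
theorem length_addDigits_le : ∀ z, (addDigits z).length ≤ z.length + 1
  | [] => by simp [addDigits]
  | (a, b) :: z => by
    have ih := length_addDigits_le z
    have h₁ := val_lt (z.map Prod.fst)
    have h₂ := val_lt (z.map Prod.snd)
    have h₃ := length_inc_le_of_val _ _ ih (by
      rw [val_addDigits, pow_succ]
      simp only [List.length_map] at *
      omega)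
    cases a <;> cases b <;> simpa [addDigits]

/-- Addition. -/
def add (x y : List Bool) : List Bool := addDigits (digits x y)

@[simp] theorem val_add (x y : List Bool) : val (add x y) = val x + val y := by
  rw [add, val_addDigits, val_digits_fst, val_digits_snd]

theorem length_add_le (x y : List Bool) : (add x y).length ≤ max x.length y.length + 1 := by
  rw [← length_digits]
  exact length_addDigits_le _

theorem polyTime_add {f g : α → List Bool} (hf : PolyTime f) (hg : PolyTime g) :
    PolyTime fun a => add (f a) (g a) := by
  refine .listRec (F := fun _ z => addDigits z) (f := fun _ => [])
    (g := fun x : α × (Bool × Bool) × List (Bool × Bool) × List Bool =>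
      (x.2.1.1 ^^ x.2.1.2) :: bif x.2.1.1 && x.2.1.2 then inc x.2.2.2 else x.2.2.2)
    (polyTime_digits hf hg) .nil ?_ (fun _ => rfl) (fun _ _ _ => rfl) (Polynomial.X + 2)
    fun a t ht => ?_
  · have h₁ : PolyTime fun x : α × (Bool × Bool) × List (Bool × Bool) × List Bool => x.2.1.1 :=
      .comp .fst (.comp .fst .snd)
    have h₂ : PolyTime fun x : α × (Bool × Bool) × List (Bool × Bool) × List Bool => x.2.1.2 :=
      .comp .snd (.comp .fst .snd)
    have h₃ : PolyTime fun x : α × (Bool × Bool) × List (Bool × Bool) × List Bool => x.2.2.2 :=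
      .comp .snd (.comp .snd .snd)
    exact .cons (h₁.xor h₂) (.cond (h₁.and h₂) (polyTime_inc h₃) h₃)
  · have h₁ := length_addDigits_le t
    have h₂ := ht.length_le
    simp only [size_eq, size_digits, Polynomial.eval_add, Polynomial.eval_X,
      Polynomial.eval_ofNat]
    omega

/-- Multiplication. -/
def mul : List Bool → List Bool → List Bool
  | [], _ => []
  | b :: x, y => add (bif b then y else []) (false :: mul x y)

@[simp] theorem val_mul : ∀ x y, val (mul x y) = val x * val y
  | [], y => by simp [mul]
  | b :: x, y => by cases b <;> simp [mul, val_mul x] <;> ring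

/-- Each digit of `x` contributes one digit for the shift and at most one for the addition. -/
theorem length_mul_le : ∀ x y, (mul x y).length ≤ y.length + 2 * x.length
  | [], y => by simp [mul]
  | b :: x, y => by
    have h₁ := length_mul_le x y
    have h₂ := length_add_le (bif b then y else []) (false :: mul x y)
    cases b <;> simp [mul] at * <;> omega

theorem polyTime_mul {f g : α → List Bool} (hf : PolyTime f) (hg : PolyTime g) :
    PolyTime fun a => mul (f a) (g a) := by
  obtain ⟨Q, hQ⟩ := hg.exists_size_le
  refine .listRec (F := fun a x => mul x (g a)) (f := fun _ => [])
    (g := fun x : α × Bool × List Bool × List Bool =>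
      add (bif x.2.1 then g x.1 else []) (false :: x.2.2.2)) hf .nil
    (polyTime_add (.cond (.comp .fst .snd) (.comp hg .fst) .nil)
      (.cons (.const_bool _) (.comp .snd (.comp .snd .snd)))) (fun _ => rfl) (fun _ _ _ => rfl)
    (4 * Polynomial.X + Q) fun a t ht => ?_
  have h₁ := length_mul_le t (g a)
  have h₂ := ht.length_le
  have h₃ := hQ a
  have h₄ := Q.eval_nat_mono (Nat.le_add_right (size a) (size (f a)))
  simp only [size_eq, Polynomial.eval_add, Polynomial.eval_X, Polynomial.eval_mul,
      Polynomial.eval_ofNat] at *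
  omega

/-- Comparison. -/
def le (x y : List Bool) : Bool :=
  (digits x y).foldl (fun c s => bif s.1 ^^ s.2 then s.2 else c) true

/-- The most significant differing pair comes last and overrides the others. The start value `c` is
the verdict in case of equality: `true` turns `<` into `≤`. -/
theorem foldl_le : ∀ (z : List (Bool × Bool)) (c : Bool),
    z.foldl (fun c s => bif s.1 ^^ s.2 then s.2 else c) c = true ↔
      val (z.map Prod.fst) < val (z.map Prod.snd) + c.toNat
  | [], c => by cases c <;> simp
  | (a, b) :: z, c => by
    rw [List.foldl_cons, foldl_le z]
    cases a <;> cases b <;> cases c <;> simp <;> omega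

theorem le_iff (x y : List Bool) : le x y = true ↔ val x ≤ val y := by
  rw [le, foldl_le, val_digits_fst, val_digits_snd]
  simp

theorem polyTime_le {f g : α → List Bool} (hf : PolyTime f) (hg : PolyTime g) :
    PolyTime fun a => le (f a) (g a) := by
  have h₁ : PolyTime fun x : Bool × Bool × Bool => x.2.1 := .comp .fst .snd
  have h₂ : PolyTime fun x : Bool × Bool × Bool => x.2.2 := .comp .snd .snd
  exact .foldl (f := fun c (s : Bool × Bool) => bif s.1 ^^ s.2 then s.2 else c)
    (.cond (h₁.xor h₂) h₂ .fst) (.const_bool true) (polyTime_digits hf hg) 1 fun a l _ => by simp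

/-- Equality of numbers. -/
def eq (x y : List Bool) : Bool := le x y && le y x

theorem eq_iff (x y : List Bool) : eq x y = true ↔ val x = val y := by
  simp [eq, Bool.and_eq_true, le_iff, Nat.le_antisymm_iff]

theorem polyTime_eq {f g : α → List Bool} (hf : PolyTime f) (hg : PolyTime g) :
    PolyTime fun a => eq (f a) (g a) :=
  (polyTime_le hf hg).and (polyTime_le hg hf)

end BinWord

/-! ### Nearest neighbor classifications on the line. -/

namespace NearestNeighbor

section Line

variable {ι : Type} (f : ι → ℝ) (lab : ι → ℕ)

/-- `a` is a nearest neighbor of `x` among the points of `P`, which lie at the positions `f`. -/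
def Near (P : List ι) (x : ℝ) (a : ι) : Prop :=
  a ∈ P ∧ ∀ b ∈ P, |x - f a| ≤ |x - f b|

/-- The points `a` and `b` of `P` are neighbors on the line, in this order. -/
def Consec (P : List ι) (a b : ι) : Prop :=
  a ∈ P ∧ b ∈ P ∧ f a < f b ∧ ∀ w ∈ P, f w ≤ f a ∨ f b ≤ f w

/-- The midpoint of `u` and `v` is also the midpoint of two neighbors in `Q` that enclose them. -/
def Covered (Q : List ι) (u v : ι) : Prop :=
  ∃ q p, Consec f Q q p ∧ f q ≤ f u ∧ f v ≤ f p ∧ f q + f p = f u + f v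

/-- The two sets of points induce the same nearest neighbor classification. -/
def SameClassification (P Q : List ι) : Prop :=
  ∀ x l, (∃ a, Near f Q x a ∧ lab a = l) ↔ ∃ a, Near f P x a ∧ lab a = l

variable {f lab} {P Q : List ι}

/-- Several points can be nearest to `x`. Choosing one closest to `y` gives the extremal element
that `closer_of_covered` would improve. -/
theorem exists_near_closest (hP : P ≠ []) (x y : ℝ) :
    ∃ a, Near f P x a ∧ ∀ b, Near f P x b → |f a - y| ≤ |f b - y| := by
  obtain ⟨a, ha⟩ := List.exists_mem_of_ne_nil P hP
  obtain ⟨b, hb, hmin⟩ := Set.exists_min_image {b | b ∈ P} (fun b => |x - f b|)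
    (List.finite_toSet P) ⟨a, ha⟩
  obtain ⟨c, hc, hc'⟩ := Set.exists_min_image {b | Near f P x b} (fun b => |f b - y|)
    ((List.finite_toSet P).subset fun b hb => hb.1) ⟨b, hb, hmin⟩
  exact ⟨c, hc, hc'⟩

/-- Take for `u` the last point up to `r` with the label of `s`, and for `v` its successor. -/
theorem exists_change (hinj : ∀ a ∈ P, ∀ b ∈ P, f a = f b → a = b) {s r : ι} (hs : s ∈ P)
    (hr : r ∈ P) (hsr : f s < f r) (hlab : lab s ≠ lab r) :
    ∃ u v, Consec f P u v ∧ lab u ≠ lab v ∧ f s ≤ f u ∧ f v ≤ f r := by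
  obtain ⟨u, ⟨hu, hur, hul⟩, humax⟩ := Set.exists_max_image
    {b | b ∈ P ∧ f b ≤ f r ∧ lab b = lab s} f
    ((List.finite_toSet P).subset fun b hb => hb.1) ⟨s, hs, hsr.le, rfl⟩
  have hur' : f u < f r := lt_of_le_of_ne hur fun h => hlab (by
    rw [← hul, hinj u hu r hr h])
  obtain ⟨v, ⟨hv, huv⟩, hvmin⟩ := Set.exists_min_image {b | b ∈ P ∧ f u < f b} f
    ((List.finite_toSet P).subset fun b hb => hb.1) ⟨r, hr, hur'⟩
  have hvr := hvmin r ⟨hr, hur'⟩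
  refine ⟨u, v, ⟨hu, hv, huv, fun w hw => ?_⟩, fun h => ?_, humax s ⟨hs, hsr.le, rfl⟩, hvr⟩
  · rcases le_or_gt (f w) (f u) with h | h
    · exact Or.inl h
    · exact Or.inr (hvmin w ⟨hw, h⟩)
  · exact absurd (humax v ⟨hv, hvr, h ▸ hul⟩) (not_le.2 huv)

/-- Some change `u, v` lies between `s` and `r`, covered by a gap `q, p` of `Q` with the same
midpoint, and `s ≤ q`. As `s` is nearest in `Q`, `x ≤ (s + p) / 2 ≤ (u + v) / 2`; as `r` is nearest
in `P`, `x ≥ (u + r) / 2 ≥ (u + v) / 2`. Equality forces `s = q`, `r = v` and `x` to be the common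
midpoint, so that `u` is nearest in `P` and `p` is nearest in `Q` as well. Both beat the given
points: `p - r = u - s < r - s`. -/
theorem closer_of_covered_aux (hinj : ∀ a ∈ P, ∀ b ∈ P, f a = f b → a = b) (hQ : Q ⊆ P)
    (hcov : ∀ u v, Consec f P u v → lab u ≠ lab v → Covered f Q u v) {x : ℝ} {s r : ι}
    (hs : Near f Q x s) (hr : Near f P x r) (hlab : lab s ≠ lab r) (hsr : f s < f r) :
    (∃ u, Near f P x u ∧ |f u - f s| < |f r - f s|) ∧
      ∃ p, Near f Q x p ∧ |f p - f r| < |f s - f r| := by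
  obtain ⟨u, v, huv, hl, hsu, hvr⟩ := exists_change hinj (hQ hs.1) hr.1 hsr hlab
  obtain ⟨q, p, hqp, hqu, hvp, hsum⟩ := hcov u v huv hl
  have h₁ : f u < f v := huv.2.2.1
  have hsq : f s ≤ f q := by
    rcases hqp.2.2.2 s hs.1 with h | h
    · exact h
    · linarith
  have hx₁ : x ≤ (f s + f p) / 2 := by
    have := hs.2 p hqp.2.1
    by_contra! h
    rw [abs_of_nonneg (by linarith)] at this
    rcases abs_cases (x - f p) with h' | h' <;> linarith
  have hx₂ : (f u + f r) / 2 ≤ x := by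
    have := hr.2 u huv.1
    by_contra! h
    rw [abs_of_nonpos (by linarith)] at this
    rcases abs_cases (x - f u) with h' | h' <;> linarith
  have e₁ : f s = f q := by linarith
  have e₂ : f r = f v := by linarith
  have e₃ : x = (f u + f v) / 2 := by linarith
  have a₁ : |x - f u| = |x - f r| := by
    rw [abs_of_nonneg (by linarith), abs_of_nonpos (by linarith)]; linarith
  have a₂ : |x - f p| = |x - f s| := by
    rw [abs_of_nonpos (by linarith), abs_of_nonneg (by linarith)]; linarith
  refine ⟨⟨u, ⟨huv.1, fun b hb => a₁ ▸ hr.2 b hb⟩, ?_⟩,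
    ⟨p, ⟨hqp.2.1, fun b hb => a₂ ▸ hs.2 b hb⟩, ?_⟩⟩
  · rw [abs_of_nonneg (by linarith), abs_of_nonneg (by linarith)]; linarith
  · rw [abs_of_nonneg (by linarith), abs_of_nonpos (by linarith)]; linarith

theorem near_neg {x : ℝ} {a : ι} : Near (fun a => -f a) P (-x) a ↔ Near f P x a := by
  have h : ∀ b, |-x - -f b| = |x - f b| := fun b => by rw [← abs_neg]; ring_nf
  simp only [Near, h]

theorem consec_neg {a b : ι} : Consec (fun a => -f a) P a b ↔ Consec f P b a := by
  simp only [Consec, neg_lt_neg_iff, neg_le_neg_iff]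
  exact ⟨fun h => ⟨h.2.1, h.1, h.2.2.1, fun w hw => (h.2.2.2 w hw).symm⟩,
    fun h => ⟨h.2.1, h.1, h.2.2.1, fun w hw => (h.2.2.2 w hw).symm⟩⟩

theorem covered_neg {a b : ι} : Covered (fun a => -f a) P a b ↔ Covered f P b a := by
  simp only [Covered, consec_neg, neg_le_neg_iff]
  exact ⟨fun ⟨q, p, h, h₁, h₂, h₃⟩ => ⟨p, q, h, h₂, h₁, by linarith⟩,
    fun ⟨q, p, h, h₁, h₂, h₃⟩ => ⟨p, q, h, h₂, h₁, by linarith⟩⟩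

/-- Reflecting the line reduces the case that `r` lies before `s` to the previous one. -/
theorem closer_of_covered (hinj : ∀ a ∈ P, ∀ b ∈ P, f a = f b → a = b) (hQ : Q ⊆ P)
    (hcov : ∀ u v, Consec f P u v → lab u ≠ lab v → Covered f Q u v) {x : ℝ} {s r : ι}
    (hs : Near f Q x s) (hr : Near f P x r) (hlab : lab s ≠ lab r) :
    (∃ u, Near f P x u ∧ |f u - f s| < |f r - f s|) ∧
      ∃ p, Near f Q x p ∧ |f p - f r| < |f s - f r| := by
  rcases lt_trichotomy (f s) (f r) with h | h | h
  · exact closer_of_covered_aux hinj hQ hcov hs hr hlab h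
  · exact absurd (congrArg lab (hinj s (hQ hs.1) r hr.1 h)) hlab
  · have := closer_of_covered_aux (f := fun a => -f a) (fun a ha b hb e => hinj a ha b hb
      (neg_injective e)) hQ (fun u v huv hl => covered_neg.2 (hcov v u (consec_neg.1 huv) hl.symm))
      (near_neg.2 hs) (near_neg.2 hr) hlab (neg_lt_neg h)
    have e : ∀ a b : ℝ, |-a - -b| = |a - b| := fun a b => by rw [← abs_neg]; ring_nf
    simpa only [near_neg, e] using this

/-- Two point sets on the line induce the same classification if and only if every boundary
between two regions is preserved. -/
theorem sameClassification_iff (hinj : ∀ a ∈ P, ∀ b ∈ P, f a = f b → a = b) (hQ : Q ⊆ P)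
    (hne : P ≠ []) : SameClassification f lab P Q ↔
      Q ≠ [] ∧ ∀ u v, Consec f P u v → lab u ≠ lab v → Covered f Q u v := by
  constructor
  · intro h
    constructor
    · rintro rfl
      obtain ⟨a, ha, -⟩ := exists_near_closest (f := f) hne 0 0
      obtain ⟨b, hb, -⟩ := (h 0 (lab a)).2 ⟨a, ha, rfl⟩
      exact absurd hb.1 List.not_mem_nil
    · intro u v huv hl
      obtain ⟨hu, hv, hlt, hgap⟩ := huv
      set x := (f u + f v) / 2 with hx
      -- No point of `P` lies strictly between `u` and `v`, so both are nearest to their midpoint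
      -- and both labels must occur there under `Q`.
      have key : ∀ w ∈ P, f v - x ≤ |x - f w| := by
        intro w hw
        rcases hgap w hw with h' | h' <;> rcases abs_cases (x - f w) with h'' | h'' <;> linarith
      have nu : Near f P x u := ⟨hu, fun w hw => by
        refine le_trans ?_ (key w hw)
        rw [abs_of_nonneg (by linarith)]; linarith⟩
      have nv : Near f P x v := ⟨hv, fun w hw => by
        refine le_trans ?_ (key w hw)
        rw [abs_of_nonpos (by linarith)]; linarith⟩
      obtain ⟨s, hs, hsl⟩ := (h x (lab u)).2 ⟨u, nu, rfl⟩
      obtain ⟨t, ht, htl⟩ := (h x (lab v)).2 ⟨v, nv, rfl⟩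
      have hst : f s ≠ f t := fun e => hl (by
        rw [← hsl, ← htl, hinj s (hQ hs.1) t (hQ ht.1) e])
      -- Two nearest neighbors of `x` in `Q` at different positions lie symmetrically around `x`,
      -- with no point of `Q` strictly between them.
      have main : ∀ s t, Near f Q x s → Near f Q x t → f s < f t → Covered f Q u v := by
        intro s t hs ht hst
        have e : |x - f s| = |x - f t| := le_antisymm (hs.2 t ht.1) (ht.2 s hs.1)
        have e' : f s + f t = 2 * x := by
          rcases abs_eq_abs.1 e with e | e <;> linarith
        refine ⟨s, t, ⟨hs.1, ht.1, hst, fun w hw => ?_⟩, ?_, ?_, by linarith⟩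
        · have h₁ := hs.2 w hw
          rw [abs_of_nonneg (by linarith)] at h₁
          rcases abs_cases (x - f w) with h' | h'
          · left; linarith
          · right; linarith
        · rcases hgap s (hQ hs.1) with h' | h' <;> linarith
        · rcases hgap t (hQ ht.1) with h' | h' <;> linarith
      rcases lt_or_gt_of_ne hst with h' | h'
      · exact main s t hs ht h'
      · exact main t s ht hs h'
  · rintro ⟨hQne, hcov⟩ x l
    constructor
    · rintro ⟨s, hs, rfl⟩
      -- A nearest neighbor in `P` with another label could be replaced by one closer to `s`, so the
      -- closest one has the label of `s`.
      obtain ⟨r, hr, hmin⟩ := exists_near_closest (f := f) hne x (f s)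
      refine ⟨r, hr, ?_⟩
      by_contra hl
      obtain ⟨⟨u, hu, hlt⟩, -⟩ := closer_of_covered hinj hQ hcov hs hr (Ne.symm hl)
      exact absurd (hmin u hu) (not_le.2 hlt)
    · rintro ⟨r, hr, rfl⟩
      obtain ⟨s, hs, hmin⟩ := exists_near_closest (f := f) hQne x (f r)
      refine ⟨s, hs, ?_⟩
      by_contra hl
      obtain ⟨-, ⟨u, hu, hlt⟩⟩ := closer_of_covered hinj hQ hcov hs hr hl
      exact absurd (hmin u hu) (not_le.2 hlt)

end Line

/-! ### Minimum reduced training sets as shortest paths. -/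

section Algorithm

variable {ι : Type}

/-- The first list is at most as long as the second. -/
def lengthLe (y r : List ι) : Bool := (r.foldl (fun t _ => t.tail) y).isEmpty

theorem foldl_tail_eq_drop (r y : List ι) :
    r.foldl (fun t _ => t.tail) y = y.drop r.length := by
  induction r generalizing y with
  | nil => rfl
  | cons a r ih => simp [ih, List.drop_tail]

theorem lengthLe_iff (y r : List ι) : lengthLe y r = true ↔ y.length ≤ r.length := by
  simp [lengthLe, foldl_tail_eq_drop]

/-- A shortest list among `x` and the members of `l`. -/
def shortestFrom (x : List ι) : List (List ι) → List ι
  | [] => x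
  | y :: l => bif lengthLe y (shortestFrom x l) then y else shortestFrom x l

theorem shortestFrom_mem (x : List ι) (l : List (List ι)) : shortestFrom x l ∈ x :: l := by
  induction l with
  | nil => simp [shortestFrom]
  | cons y l ih =>
    rw [shortestFrom]
    cases lengthLe y (shortestFrom x l)
    · simp at ih ⊢; tauto
    · simp

theorem shortestFrom_length_le (x : List ι) (l : List (List ι)) :
    ∀ z ∈ x :: l, (shortestFrom x l).length ≤ z.length := by
  induction l with
  | nil => simp [shortestFrom]
  | cons y l ih =>
    intro z hz
    have hz' : z = y ∨ z ∈ x :: l := by simp at hz ⊢; tauto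
    rw [shortestFrom]
    cases h : lengthLe y (shortestFrom x l)
    · have : ¬ y.length ≤ (shortestFrom x l).length := by rw [← lengthLe_iff, h]; simp
      rcases hz' with rfl | hz'
      · simp; omega
      · simpa using ih z hz'
    · rw [lengthLe_iff] at h
      rcases hz' with rfl | hz'
      · simp
      · simpa using h.trans (ih z hz')

/-- A shortest member of a list of lists. -/
def shortest : List (List ι) → List ι
  | [] => []
  | x :: l => shortestFrom x l

theorem shortest_mem {l : List (List ι)} (h : l ≠ []) : shortest l ∈ l := by
  cases l with
  | nil => exact absurd rfl h
  | cons x l => exact shortestFrom_mem x l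

theorem shortest_length_le {l : List (List ι)} {z : List ι} (h : z ∈ l) :
    (shortest l).length ≤ z.length := by
  cases l with
  | nil => simp at h
  | cons x l => exact shortestFrom_length_le x l z h

/-- The head of a list exists and satisfies a property. -/
def headSat (r : ι → Bool) : List ι → Bool
  | [] => false
  | q :: _ => r q

/-- Add the extension of a shortest list in `c` by `p`, if there is one. -/
def extend (p : ι) (c s : List (List ι)) : List (List ι) :=
  match c with
  | [] => s
  | x :: l => (p :: shortestFrom x l) :: s

/-- For every possible first point, a shortest path through a list to a final point. -/
def paths (r : ι → ι → Bool) (e : ι → Bool) : List ι → List (List ι)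
  | [] => []
  | p :: l => bif e p then [p] :: paths r e l
      else extend p ((paths r e l).filter fun s => headSat (r p) s) (paths r e l)

/-- Subsequent members of the list are related by `r`, and the last one satisfies `e`. -/
def IsPath (r : ι → ι → Bool) (e : ι → Bool) : List ι → Prop
  | [] => False
  | [p] => e p = true
  | p :: q :: l => r p q = true ∧ IsPath r e (q :: l)

variable {r : ι → ι → Bool} {e : ι → Bool}

theorem mem_extend {p : ι} {c s : List (List ι)} {x : List ι} (h : x ∈ extend p c s) :
    x ∈ s ∨ ∃ y ∈ c, x = p :: y := by
  cases c with
  | nil => exact Or.inl h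
  | cons y c =>
    rcases List.mem_cons.1 h with h | h
    · exact Or.inr ⟨_, shortestFrom_mem _ _, h⟩
    · exact Or.inl h

theorem subset_extend {p : ι} {c s : List (List ι)} : s ⊆ extend p c s := by
  cases c with
  | nil => exact fun _ h => h
  | cons y c => exact fun _ h => List.mem_cons_of_mem _ h

theorem paths_sound : ∀ {l x : List ι}, x ∈ paths r e l → x.Sublist l ∧ IsPath r e x
  | [], x, h => by simp [paths] at h
  | p :: l, x, h => by
    rw [paths] at h
    cases hp : e p
    · rw [hp] at h
      rcases mem_extend h with h | ⟨y, hy, rfl⟩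
      · exact ⟨(paths_sound h).1.cons _, (paths_sound h).2⟩
      · obtain ⟨hy, hy'⟩ := List.mem_filter.1 hy
        obtain ⟨h₁, h₂⟩ := paths_sound hy
        refine ⟨h₁.cons_cons p, ?_⟩
        cases y with
        | nil => simp [headSat] at hy'
        | cons q y => exact ⟨hy', h₂⟩
    · rw [hp] at h
      rcases List.mem_cons.1 h with rfl | h
      · exact ⟨by simp, hp⟩
      · exact ⟨(paths_sound h).1.cons _, (paths_sound h).2⟩

/-- Whether `p` can be prepended depends only on the head `q` of the remaining path. So that path
may be exchanged for the stored one from `q`, which is no longer; one path per starting point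
suffices. -/
theorem paths_complete : ∀ {l : List ι} {p : ι} {s : List ι}, (p :: s).Sublist l →
    IsPath r e (p :: s) → ∃ y, p :: y ∈ paths r e l ∧ y.length ≤ s.length
  | [], p, s, h, _ => by simp at h
  | a :: l, p, s, h, hs => by
    have hsub : paths r e l ⊆ paths r e (a :: l) := by
      rw [paths]
      cases e a
      · exact subset_extend
      · exact fun _ h => List.mem_cons_of_mem _ h
    rcases List.sublist_cons_iff.1 h with h | ⟨s', h', h⟩
    · obtain ⟨y, hy, hy'⟩ := paths_complete h hs
      exact ⟨y, hsub hy, hy'⟩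
    · obtain ⟨rfl, rfl⟩ := List.cons.inj h'
      cases hp : e p
      · cases s with
        | nil => exact absurd (show e p = true from hs) (by simp [hp])
        | cons q s =>
          obtain ⟨hpq, hs⟩ := hs
          obtain ⟨y, hy, hy'⟩ := paths_complete h hs
          have hmem : q :: y ∈ (paths r e l).filter fun s => headSat (r p) s :=
            List.mem_filter.2 ⟨hy, hpq⟩
          rw [paths, hp, cond_false]
          generalize (paths r e l).filter (fun s => headSat (r p) s) = c at hmem
          cases c with
          | nil => simp at hmem
          | cons x c =>
            refine ⟨_, List.mem_cons_self, (shortestFrom_length_le x c _ hmem).trans ?_⟩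
            simpa using hy'
      · exact ⟨[], by simp [paths, hp], by simp⟩

/-- Each point adds at most one path; this keeps the search polynomial. -/
theorem length_paths_le (l : List ι) : (paths r e l).length ≤ l.length := by
  induction l with
  | nil => simp [paths]
  | cons p l ih =>
    rw [paths]
    cases e p
    · simp only [cond_false, List.length_cons]
      cases (paths r e l).filter fun s => headSat (r p) s
      · simpa [extend] using ih.trans (Nat.le_succ _)
      · simpa [extend] using ih
    · simpa using ih

/-- Prepend the pair of `u` and the head of `t`, if the two are not related by `same`. -/
def changesStep (same : ι → ι → Bool) (u : ι) (t : List ι) (c : List (ι × ι)) : List (ι × ι) :=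
  match t with
  | [] => c
  | v :: _ => bif same u v then c else (u, v) :: c

/-- The pairs of subsequent members of the list that are not related by `same`. -/
def changes (same : ι → ι → Bool) : List ι → List (ι × ι)
  | [] => []
  | u :: t => changesStep same u t (changes same t)

theorem mem_changes {same : ι → ι → Bool} {u v : ι} :
    ∀ {l : List ι}, (u, v) ∈ changes same l ↔ [u, v] <:+: l ∧ same u v = false
  | [] => by simp [changes]
  | [a] => by
    have h : ¬ [u, v] <:+: [a] := fun h => by simpa using h.length_le
    simp [changes, changesStep, h]
  | a :: b :: l => by
    rw [changes, List.infix_cons_iff, or_and_right, ← mem_changes (l := b :: l)]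
    simp only [changesStep, List.cons_prefix_cons, List.nil_prefix, and_true]
    cases h : same a b
    · simp only [cond_false, List.mem_cons, Prod.mk.injEq]
      constructor
      · rintro (⟨rfl, rfl⟩ | h')
        · exact Or.inl ⟨⟨rfl, rfl⟩, h⟩
        · exact Or.inr h'
      · rintro (⟨⟨rfl, rfl⟩, -⟩ | h')
        · exact Or.inl ⟨rfl, rfl⟩
        · exact Or.inr h'
    · simp only [cond_true]
      refine ⟨Or.inr, ?_⟩
      rintro (⟨⟨rfl, rfl⟩, h'⟩ | h')
      · simp [h] at h'
      · exact h'

variable (le : ι → ι → Bool) (sumEq : ι × ι → ι × ι → Bool) (same : ι → ι → Bool)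

/-- The gap between `p` and `q` reproduces all changes of the label within it. -/
def linked (c : List (ι × ι)) (p q : ι) : Bool :=
  c.all fun s => !(le p s.1 && le s.2 q) || sumEq s (p, q)

/-- There is no change of the label after `p`. -/
def isEnd (c : List (ι × ι)) (p : ι) : Bool := c.all fun s => !le p s.1

/-- There is no change of the label before `q`. -/
def isStart (c : List (ι × ι)) (q : ι) : Bool := c.all fun s => !le s.2 q

/-- A reduced training set of minimum cardinality, for points that are sorted. -/
def reduceSorted (l : List ι) : List ι :=
  shortest ((paths (linked le sumEq (changes same l)) (isEnd le (changes same l)) l).filter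
    fun s => headSat (isStart le (changes same l)) s)

/-- A reduced training set of minimum cardinality. -/
def reduce (l : List ι) : List ι :=
  reduceSorted le sumEq same (l.insertionSort fun a b => le a b = true)

variable {le sumEq same} {f : ι → ℝ} {lab : ι → ℕ}

/-- Replaces neighborhood on the line by adjacency in the sorted list, which recursion can follow.
-/
theorem infix_pair_iff {l : List ι} (hl : l.Pairwise fun a b => f a < f b) {a b : ι} :
    [a, b] <:+: l ↔ Consec f l a b := by
  constructor
  · rintro ⟨s, t, rfl⟩
    simp only [List.append_assoc, List.cons_append, List.nil_append, List.pairwise_append,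
      List.pairwise_cons, List.mem_cons] at hl
    obtain ⟨-, ⟨h₁, h₂, -⟩, h₃⟩ := hl
    refine ⟨by simp, by simp, h₁ b (Or.inl rfl), fun w hw => ?_⟩
    simp only [List.append_assoc, List.cons_append, List.nil_append, List.mem_append,
      List.mem_cons] at hw
    rcases hw with hw | rfl | rfl | hw
    · exact Or.inl (h₃ w hw a (Or.inl rfl)).le
    · exact Or.inl le_rfl
    · exact Or.inr le_rfl
    · exact Or.inr (h₂ w hw).le
  · rintro ⟨ha, hb, hab, hw⟩
    obtain ⟨s, t, rfl⟩ := List.append_of_mem ha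
    rw [List.pairwise_append, List.pairwise_cons] at hl
    obtain ⟨-, ⟨h₁, h₂⟩, h₃⟩ := hl
    have hbt : b ∈ t := by
      rcases List.mem_append.1 hb with h | h
      · exact absurd (h₃ b h a (by simp)) (not_lt.2 hab.le)
      · rcases List.mem_cons.1 h with rfl | h
        · exact absurd hab (lt_irrefl _)
        · exact h
    cases t with
    | nil => simp at hbt
    | cons c t =>
      rcases List.mem_cons.1 hbt with rfl | hbt
      · exact ⟨s, t, by simp⟩
      · have h₄ := (List.pairwise_cons.1 h₂).1 b hbt
        have h₅ := h₁ c (by simp)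
        rcases hw c (by simp) with h | h
        · exact absurd h (not_le.2 h₅)
        · exact absurd h (not_le.2 h₄)

section Specification

variable (hle : ∀ a b, le a b = true ↔ f a ≤ f b)
  (hsum : ∀ a b, sumEq a b = true ↔ f a.1 + f a.2 = f b.1 + f b.2)
  (hsame : ∀ a b, same a b = true ↔ lab a = lab b)

-- A change is a pair of neighbors of `P`, and the path runs through points of `P`, so no point of
-- the path lies strictly inside a change. Every change from `p` on therefore lies in the first gap,
-- where `linked` controls it, or after `q`, where the induction hypothesis does. A path of a single
-- point has no gap and covers nothing.
include hle hsum in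
theorem isPath_iff {P : List ι} {c : List (ι × ι)} (hc : ∀ s ∈ c, Consec f P s.1 s.2) :
    ∀ {s : List ι} {p : ι}, p :: s ⊆ P → (p :: s).Pairwise (fun a b => f a < f b) →
      (IsPath (linked le sumEq c) (isEnd le c) (p :: s) ↔
        ∀ x ∈ c, f p ≤ f x.1 → Covered f (p :: s) x.1 x.2)
  | [], p, hsub, hs => by
    have hcov : ∀ u v, ¬ Covered f [p] u v := by
      rintro u v ⟨a, b, h, -⟩
      rw [← infix_pair_iff hs] at h
      simpa using h.length_le
    simp [IsPath, isEnd, hcov, ← hle]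
  | q :: s, p, hsub, hs => by
    have ih := isPath_iff hc (s := s) (p := q) (fun a ha => hsub (by simp [ha]))
      (List.pairwise_cons.1 hs).2
    have hs' := (List.pairwise_cons.1 hs).2
    have hpq : f p < f q := (List.pairwise_cons.1 hs).1 q (by simp)
    have hcov : ∀ u v, Covered f (p :: q :: s) u v ↔
        (f p ≤ f u ∧ f v ≤ f q ∧ f p + f q = f u + f v) ∨ Covered f (q :: s) u v := by
      intro u v
      simp only [Covered, ← infix_pair_iff hs, ← infix_pair_iff hs', List.infix_cons_iff (a := p),
        List.cons_prefix_cons, List.nil_prefix, and_true]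
      constructor
      · rintro ⟨a, b, ⟨rfl, rfl⟩ | h, h'⟩
        · exact Or.inl h'
        · exact Or.inr ⟨a, b, h, h'⟩
      · rintro (h' | ⟨a, b, h, h'⟩)
        · exact ⟨p, q, Or.inl ⟨rfl, rfl⟩, h'⟩
        · exact ⟨a, b, Or.inr h, h'⟩
    have hlink : linked le sumEq c p q = true ↔
        ∀ x ∈ c, f p ≤ f x.1 → f x.2 ≤ f q → f p + f q = f x.1 + f x.2 := by
      simp only [linked, List.all_eq_true]
      refine forall₂_congr fun x _ => ?_
      rw [Bool.or_eq_true, hsum, Bool.not_eq_true', ← Bool.not_eq_true, Bool.and_eq_true, hle, hle]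
      constructor
      · rintro (h | h) h₁ h₂
        · exact absurd ⟨h₁, h₂⟩ h
        · exact h.symm
      · intro h
        by_cases h' : f p ≤ f x.1 ∧ f x.2 ≤ f q
        · exact Or.inr (h h'.1 h'.2).symm
        · exact Or.inl h'
    rw [IsPath, ih, hlink]
    constructor
    · rintro ⟨h₁, h₂⟩ x hx hpx
      rw [hcov]
      rcases (hc x hx).2.2.2 q (hsub (by simp)) with h | h
      · exact Or.inr (h₂ x hx h)
      · exact Or.inl ⟨hpx, h, h₁ x hx hpx h⟩
    · intro h
      refine ⟨fun x hx h₁ h₂ => ?_, fun x hx h₁ => ?_⟩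
      · rcases (hcov _ _).1 (h x hx h₁) with h' | ⟨a, b, hab, h₃, -⟩
        · exact h'.2.2
        · have hqa : f q ≤ f a := by
            rcases List.mem_cons.1 hab.1 with h | h
            · rw [h]
            · exact ((List.pairwise_cons.1 hs').1 a h).le
          exact absurd (hc x hx).2.2.1 (not_lt.2 (h₂.trans (hqa.trans h₃)))
      · rcases (hcov _ _).1 (h x hx (hpq.le.trans h₁)) with h' | h'
        · exact absurd (hc x hx).2.2.1 (not_lt.2 (h'.2.1.trans h₁))
        · exact h'

-- `isPath_iff` accounts for the changes from `p` on. All others end at or before `p`, where no gap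
-- of `p :: s` can cover them, and `isStart` excludes exactly these.
include hle hsum hsame in
theorem isPath_start_iff {l : List ι} (hl : l.Pairwise fun a b => f a < f b) {p : ι}
    {s : List ι} (hs : (p :: s).Sublist l) :
    IsPath (linked le sumEq (changes same l)) (isEnd le (changes same l)) (p :: s) ∧
      isStart le (changes same l) p = true ↔ SameClassification f lab l (p :: s) := by
  have hc : ∀ u v, (u, v) ∈ changes same l ↔ Consec f l u v ∧ lab u ≠ lab v := by
    intro u v
    rw [mem_changes, infix_pair_iff hl, ← Bool.not_eq_true, hsame]
  have hinj : ∀ a ∈ l, ∀ b ∈ l, f a = f b → a = b := by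
    intro a ha b hb hab
    by_contra hne
    exact List.Pairwise.forall_of_forall_of_flip (R := fun a b => a ≠ b → f a ≠ f b)
      (by simp) (hl.imp fun h _ => h.ne) (hl.imp fun h _ => h.ne') ha hb hne hab
  rw [sameClassification_iff hinj hs.subset (by rintro rfl; simp at hs),
    isPath_iff hle hsum (P := l) (fun x hx => ((hc x.1 x.2).1 hx).1) hs.subset (hl.sublist hs)]
  have hp : p ∈ l := hs.subset (by simp)
  have hstart : isStart le (changes same l) p = true ↔
      ∀ x ∈ changes same l, ¬ f x.2 ≤ f p := by
    simp [isStart, ← hle]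
  rw [hstart]
  constructor
  · rintro ⟨h₁, h₂⟩
    refine ⟨by simp, fun u v huv hne => ?_⟩
    have hmem := (hc u v).2 ⟨huv, hne⟩
    refine h₁ _ hmem ?_
    rcases huv.2.2.2 p hp with h | h
    · exact h
    · exact absurd h (h₂ _ hmem)
  · rintro ⟨-, h⟩
    refine ⟨fun x hx _ => h _ _ ((hc _ _).1 hx).1 ((hc _ _).1 hx).2, fun x hx hxp => ?_⟩
    obtain ⟨hx₁, hx₂⟩ := (hc _ _).1 hx
    obtain ⟨a, b, hab, h₁, -⟩ := h _ _ hx₁ hx₂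
    have hpa : f p ≤ f a := by
      rcases List.mem_cons.1 hab.1 with h | h
      · rw [h]
      · exact ((List.pairwise_cons.1 (hl.sublist hs)).1 a h).le
    have := hx₁.2.2.1
    linarith

include hle hsum hsame in
theorem reduceSorted_spec {l : List ι} (hl : l.Pairwise fun a b => f a < f b) (hne : l ≠ []) :
    (reduceSorted le sumEq same l).Sublist l ∧
      SameClassification f lab l (reduceSorted le sumEq same l) ∧
      ∀ s, s.Sublist l → SameClassification f lab l s →
        (reduceSorted le sumEq same l).length ≤ s.length := by
  have key : ∀ s, s.Sublist l → SameClassification f lab l s →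
      ∃ y ∈ (paths (linked le sumEq (changes same l)) (isEnd le (changes same l)) l).filter
        fun s => headSat (isStart le (changes same l)) s, y.length ≤ s.length := by
    intro s hs hcl
    cases s with
    | nil =>
      obtain ⟨a, ha, -⟩ := exists_near_closest (f := f) hne 0 0
      obtain ⟨b, hb, -⟩ := (hcl 0 (lab a)).2 ⟨a, ha, rfl⟩
      exact absurd hb.1 List.not_mem_nil
    | cons p s =>
      obtain ⟨h₁, h₂⟩ := (isPath_start_iff hle hsum hsame hl hs).2 hcl
      obtain ⟨y, hy, hy'⟩ := paths_complete hs h₁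
      exact ⟨_, List.mem_filter.2 ⟨hy, h₂⟩, by simpa using hy'⟩
  -- The whole point set is a solution, so there is a candidate and `shortest` does not return its
  -- default.
  obtain ⟨y, hy, -⟩ := key l (List.Sublist.refl l) fun _ _ => Iff.rfl
  have hmem := shortest_mem (List.ne_nil_of_mem hy)
  obtain ⟨h₁, h₂⟩ := List.mem_filter.1 hmem
  obtain ⟨h₃, h₄⟩ := paths_sound h₁
  refine ⟨h₃, ?_, fun s hs hcl => ?_⟩
  · unfold reduceSorted
    generalize shortest _ = z at *
    cases z with
    | nil => exact absurd h₄ (by simp [IsPath])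
    | cons p s => exact (isPath_start_iff hle hsum hsame hl h₃).1 ⟨h₄, h₂⟩
  · obtain ⟨y, hy, hy'⟩ := key s hs hcl
    exact (shortest_length_le hy).trans hy'

theorem SameClassification.congr {P P' Q Q' : List ι} (h : SameClassification f lab P Q)
    (hP : ∀ a, a ∈ P ↔ a ∈ P') (hQ : ∀ a, a ∈ Q ↔ a ∈ Q') : SameClassification f lab P' Q' := by
  simpa only [SameClassification, Near, hP, hQ] using h

include hle hsum hsame in
/-- The computed list is a reduced training set of minimum cardinality. -/
theorem reduce_spec {l : List ι} (hl : l.Pairwise fun a b => f a ≠ f b) (hne : l ≠ []) :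
    (reduce le sumEq same l).Nodup ∧ reduce le sumEq same l ⊆ l ∧
      SameClassification f lab l (reduce le sumEq same l) ∧
      ∀ s, s.Nodup → s ⊆ l → SameClassification f lab l s →
        (reduce le sumEq same l).length ≤ s.length := by
  classical
  set l' := l.insertionSort fun a b => le a b = true with hl'
  have hperm : l'.Perm l := List.perm_insertionSort _ l
  have hmem : ∀ a, a ∈ l' ↔ a ∈ l := fun a => hperm.mem_iff
  have : Std.Total fun a b => le a b = true := ⟨fun a b => by
    simpa only [hle] using le_total (f a) (f b)⟩
  have : IsTrans ι fun a b => le a b = true := ⟨fun a b c => by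
    simpa only [hle] using le_trans⟩
  have hsort : l'.Pairwise fun a b => f a < f b := by
    have h₁ := List.pairwise_insertionSort (fun a b => le a b = true) l
    have h₂ : l'.Pairwise fun a b => f a ≠ f b := hperm.symm.pairwise hl fun h => h.symm
    exact (h₁.and h₂).imp fun h => lt_of_le_of_ne ((hle _ _).1 h.1) h.2
  have hnodup : l'.Nodup := hsort.imp fun h => ne_of_apply_ne f h.ne
  obtain ⟨h₁, h₂, h₃⟩ := reduceSorted_spec hle hsum hsame hsort (fun h => hne (by
    rw [h] at hperm; exact hperm.nil_eq.symm))
  refine ⟨hnodup.sublist h₁, fun a ha => (hmem a).1 (h₁.subset ha), h₂.congr hmem fun _ => Iff.rfl,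
    fun s hs hsub hcl => ?_⟩
  -- Up to order, every competitor is a sublist of the sorted list.
  have hs' : (l'.filter fun a => decide (a ∈ s)).Perm s := by
    rw [List.perm_ext_iff_of_nodup (hnodup.filter _) hs]
    intro a
    simp only [List.mem_filter, decide_eq_true_eq, hmem]
    exact ⟨fun h => h.2, fun h => ⟨hsub h, h⟩⟩
  rw [← hs'.length_eq]
  exact h₃ _ List.filter_sublist (hcl.congr (fun a => (hmem a).symm) fun a => hs'.mem_iff.symm)

end Specification

end Algorithm

end NearestNeighbor

/-! ### Running time of the shortest path algorithm. -/

theorem size_perm {α : Type} [TreeEnc α] {l l' : List α} (h : l.Perm l') : size l = size l' := by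
  induction h with
  | nil => rfl
  | cons a _ ih => simp [ih]
  | swap a b l => simp only [size_cons]; omega
  | trans _ _ h₁ h₂ => exact h₁.trans h₂

namespace NearestNeighbor

variable {α ι : Type} [TreeEnc α] [TreeEnc ι]

theorem polyTime_lengthLe {y r : α → List ι} (hy : PolyTime y) (hr : PolyTime r) :
    PolyTime fun a => lengthLe (y a) (r a) := by
  have h₁ : PolyTime fun a => (r a).foldl (fun t _ => t.tail) (y a) := by
    obtain ⟨P, hP⟩ := hy.exists_size_le
    refine .foldl (f := fun (t : List ι) (_ : ι) => t.tail) (.tail .fst) hy hr P fun a l _ => ?_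
    rw [foldl_tail_eq_drop]
    exact (size_le_of_sublist (List.drop_sublist _ _)).trans (hP a)
  exact .listCase (F := fun _ l => l.isEmpty) (g := fun _ => false) h₁ (.const_bool true)
    (.const_bool false) (fun _ => rfl) fun _ _ _ => rfl

theorem polyTime_shortestFrom {x : α → List ι} {l : α → List (List ι)} (hx : PolyTime x)
    (hl : PolyTime l) : PolyTime fun a => shortestFrom (x a) (l a) := by
  obtain ⟨P, hP⟩ := hx.exists_size_le
  have h₁ : PolyTime fun z : α × List ι × List (List ι) × List ι => z.2.1 := .comp .fst .snd
  have h₂ : PolyTime fun z : α × List ι × List (List ι) × List ι => z.2.2.2 :=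
    .comp .snd (.comp .snd .snd)
  refine .listRec (F := fun a l => shortestFrom (x a) l)
    (g := fun z => bif lengthLe z.2.1 z.2.2.2 then z.2.1 else z.2.2.2) hl hx
    (.cond (polyTime_lengthLe h₁ h₂) h₁ h₂) (fun _ => rfl) (fun _ _ _ => rfl)
    (Polynomial.X + P) fun a t ht => ?_
  have h₃ := hP a
  have h₄ := P.eval_nat_mono (Nat.le_add_right (size a) (size (l a)))
  have h₅ := size_le_of_sublist ht.sublist
  simp only [Polynomial.eval_add, Polynomial.eval_X]
  rcases List.mem_cons.1 (shortestFrom_mem (x a) t) with h | h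
  · rw [h]; omega
  · have := size_le_of_mem h; omega

theorem polyTime_shortest {l : α → List (List ι)} (hl : PolyTime l) :
    PolyTime fun a => shortest (l a) :=
  .listCase (F := fun _ l => shortest l) (g := fun z => shortestFrom z.2.1 z.2.2) hl .nil
    (polyTime_shortestFrom (.comp .fst .snd) (.comp .snd .snd)) (fun _ => rfl) fun _ _ _ => rfl

theorem polyTime_headSat {r : α × ι → Bool} {l : α → List ι} (hr : PolyTime r)
    (hl : PolyTime l) : PolyTime fun a => headSat (fun q => r (a, q)) (l a) :=
  .listCase (F := fun a l => headSat (fun q => r (a, q)) l) (g := fun z => r (z.1, z.2.1)) hl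
    (.const_bool false) (hr.comp (.pair .fst (.comp .fst .snd))) (fun _ => rfl) fun _ _ _ => rfl

theorem polyTime_extend {p : α → ι} {c s : α → List (List ι)} (hp : PolyTime p)
    (hc : PolyTime c) (hs : PolyTime s) : PolyTime fun a => extend (p a) (c a) (s a) :=
  .listCase (F := fun a c => extend (p a) c (s a))
    (g := fun z => (p z.1 :: shortestFrom z.2.1 z.2.2) :: s z.1) hc hs
    (.cons (.cons (hp.comp .fst) (polyTime_shortestFrom (.comp .fst .snd) (.comp .snd .snd)))
      (hs.comp .fst)) (fun _ => rfl) fun _ _ _ => rfl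

theorem polyTime_paths {r : α × ι × ι → Bool} {e : α × ι → Bool} {l : α → List ι}
    (hr : PolyTime r) (he : PolyTime e) (hl : PolyTime l) :
    PolyTime fun a => paths (fun p q => r (a, p, q)) (fun p => e (a, p)) (l a) := by
  have h₁ : PolyTime fun z : α × ι × List ι × List (List ι) => z.2.1 := .comp .fst .snd
  have h₂ : PolyTime fun z : α × ι × List ι × List (List ι) => z.2.2.2 :=
    .comp .snd (.comp .snd .snd)
  have h₃ : PolyTime fun z : α × ι × List ι × List (List ι) =>
      z.2.2.2.filter fun s => headSat (fun q => r (z.1, z.2.1, q)) s :=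
    .filter (f := fun y : (α × ι × List ι × List (List ι)) × List ι =>
      headSat (fun q => r (y.1.1, y.1.2.1, q)) y.2)
      (polyTime_headSat (r := fun x : ((α × ι × List ι × List (List ι)) × List ι) × ι =>
        r (x.1.1.1, x.1.1.2.1, x.2)) (hr.comp (.pair (.comp .fst (.comp .fst .fst))
          (.pair (h₁.comp (.comp .fst .fst)) .snd))) .snd) h₂
  refine .listRec (F := fun a l => paths (fun p q => r (a, p, q)) (fun p => e (a, p)) l)
    (g := fun z => bif e (z.1, z.2.1) then [z.2.1] :: z.2.2.2 else
      extend z.2.1 (z.2.2.2.filter fun s => headSat (fun q => r (z.1, z.2.1, q)) s) z.2.2.2)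
    hl .nil (.cond (he.comp (.pair .fst h₁)) (.cons (.cons h₁ .nil) h₂)
      (polyTime_extend h₁ h₃ h₂)) (fun _ => rfl) (fun _ _ _ => rfl)
    (Polynomial.X * (Polynomial.X + 1) + 1) fun a t ht => ?_
  -- There are at most as many stored paths as points, and each is a sublist of the input, which
  -- gives a quadratic bound.
  have h₄ := size_list_le (l := paths (fun p q => r (a, p, q)) (fun p => e (a, p)) t)
    (n := size a + size (l a)) fun x hx => by
      have h₁ := size_le_of_sublist ((paths_sound hx).1.trans ht.sublist)
      omega
  refine h₄.trans ?_
  have h₅ : (paths (fun p q => r (a, p, q)) (fun p => e (a, p)) t).length ≤ size a + size (l a) :=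
    (length_paths_le t).trans (ht.length_le.trans ((length_le_size _).trans (Nat.le_add_left _ _)))
  simp only [Polynomial.eval_add, Polynomial.eval_mul, Polynomial.eval_X, Polynomial.eval_one]
  gcongr

variable {le : ι → ι → Bool} {sumEq : ι × ι → ι × ι → Bool} {same : ι → ι → Bool}
  (hle : PolyTime fun x : ι × ι => le x.1 x.2)
  (hsum : PolyTime fun x : (ι × ι) × ι × ι => sumEq x.1 x.2)
  (hsame : PolyTime fun x : ι × ι => same x.1 x.2)

/-- The first point occurs in at most one pair, every other point in at most two. -/
theorem size_changes_le (same : ι → ι → Bool) : ∀ (u : ι) (l : List ι),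
    size (changes same (u :: l)) ≤ size u + 2 * size l
  | u, [] => by simp [changes, changesStep]
  | u, v :: l => by
    have ih := size_changes_le same v l
    rw [changes]
    simp only [changesStep]
    cases same u v
    · simp
      omega
    · simp
      omega

include hsame in
theorem polyTime_changes {l : α → List ι} (hl : PolyTime l) :
    PolyTime fun a => changes same (l a) := by
  have h₁ : PolyTime fun z : α × ι × List ι × List (ι × ι) => z.2.1 := .comp .fst .snd
  have h₂ : PolyTime fun z : α × ι × List ι × List (ι × ι) => z.2.2.1 :=
    .comp .fst (.comp .snd .snd)
  have h₃ : PolyTime fun z : α × ι × List ι × List (ι × ι) => z.2.2.2 :=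
    .comp .snd (.comp .snd .snd)
  have h₄ : PolyTime fun z : α × ι × List ι × List (ι × ι) =>
      changesStep same z.2.1 z.2.2.1 z.2.2.2 := by
    have k₁ : PolyTime fun y : (α × ι × List ι × List (ι × ι)) × ι × List ι => y.1.2.1 :=
      h₁.comp .fst
    have k₂ : PolyTime fun y : (α × ι × List ι × List (ι × ι)) × ι × List ι => y.2.1 :=
      .comp .fst .snd
    have k₃ : PolyTime fun y : (α × ι × List ι × List (ι × ι)) × ι × List ι => y.1.2.2.2 :=
      h₃.comp .fst
    exact .listCase (F := fun (z : α × ι × List ι × List (ι × ι)) t =>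
        changesStep same z.2.1 t z.2.2.2)
      (g := fun y => bif same y.1.2.1 y.2.1 then y.1.2.2.2 else (y.1.2.1, y.2.1) :: y.1.2.2.2) h₂ h₃
      (.cond (hsame.comp (k₁.pair k₂)) k₃ (.cons (k₁.pair k₂) k₃)) (fun _ => rfl) fun _ _ _ => rfl
  refine .listRec (F := fun _ l => changes same l)
    (g := fun z => changesStep same z.2.1 z.2.2.1 z.2.2.2) hl .nil h₄ (fun _ => rfl)
    (fun _ _ _ => rfl) (2 * Polynomial.X + 1) fun a t ht => ?_
  have h₅ := size_le_of_sublist ht.sublist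
  cases t with
  | nil => simp [changes]
  | cons u t =>
    have h₆ := size_changes_le same u t
    simp at h₅ ⊢
    omega

include hle in
theorem polyTime_isEnd {c : α → List (ι × ι)} {p : α → ι} (hc : PolyTime c) (hp : PolyTime p) :
    PolyTime fun a => isEnd le (c a) (p a) :=
  .all (f := fun x : α × ι × ι => !le (p x.1) x.2.1)
    (hle.comp (.pair (hp.comp .fst) (.comp .fst .snd))).not hc

include hle in
theorem polyTime_isStart {c : α → List (ι × ι)} {p : α → ι} (hc : PolyTime c)
    (hp : PolyTime p) : PolyTime fun a => isStart le (c a) (p a) :=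
  .all (f := fun x : α × ι × ι => !le x.2.2 (p x.1))
    (hle.comp (.pair (.comp .snd .snd) (hp.comp .fst))).not hc

include hle hsum in
theorem polyTime_linked {c : α → List (ι × ι)} {p q : α → ι} (hc : PolyTime c)
    (hp : PolyTime p) (hq : PolyTime q) : PolyTime fun a => linked le sumEq (c a) (p a) (q a) :=
  .all (f := fun x : α × ι × ι => !(le (p x.1) x.2.1 && le x.2.2 (q x.1)) ||
      sumEq x.2 (p x.1, q x.1))
    (.or (.not (.and (hle.comp (.pair (hp.comp .fst) (.comp .fst .snd)))
      (hle.comp (.pair (.comp .snd .snd) (hq.comp .fst)))))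
      (hsum.comp (.pair .snd (.pair (hp.comp .fst) (hq.comp .fst))))) hc

include hle in
theorem polyTime_insertionSort {l : α → List ι} (hl : PolyTime l) :
    PolyTime fun a => (l a).insertionSort fun a b => le a b = true := by
  have hins : PolyTime fun x : ι × List ι => x.2.orderedInsert (fun a b => le a b = true) x.1 := by
    have k₁ : PolyTime fun y : (ι × List ι) × ι × List ι × List ι => y.1.1 := .comp .fst .fst
    have k₂ : PolyTime fun y : (ι × List ι) × ι × List ι × List ι => y.2.1 := .comp .fst .snd
    have k₃ : PolyTime fun y : (ι × List ι) × ι × List ι × List ι => y.2.2.1 :=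
      .comp .fst (.comp .snd .snd)
    have k₄ : PolyTime fun y : (ι × List ι) × ι × List ι × List ι => y.2.2.2 :=
      .comp .snd (.comp .snd .snd)
    refine .listRec (F := fun (x : ι × List ι) l => l.orderedInsert (fun a b => le a b = true) x.1)
      (f := fun x => [x.1]) (g := fun y => bif le y.1.1 y.2.1 then y.1.1 :: y.2.1 :: y.2.2.1
        else y.2.1 :: y.2.2.2) .snd (.cons .fst .nil)
      (.cond (hle.comp (k₁.pair k₂)) (.cons k₁ (.cons k₂ k₃)) (.cons k₂ k₄))
      (fun _ => rfl) (fun x b t => ?_) (Polynomial.X + 1) fun x t ht => ?_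
    · simp only [List.orderedInsert]
      split_ifs with h
      · rw [h, cond_true]
      · rw [Bool.not_eq_true] at h
        rw [h, cond_false]
    · rw [size_perm (List.perm_orderedInsert _ _ _)]
      have h₁ := size_le_of_sublist ht.sublist
      obtain ⟨a, l⟩ := x
      simp at h₁ ⊢
      omega
  refine .listRec (F := fun _ l => l.insertionSort fun a b => le a b = true)
    (g := fun z => z.2.2.2.orderedInsert (fun a b => le a b = true) z.2.1) hl .nil
    (hins.comp (.pair (.comp .fst .snd) (.comp .snd (.comp .snd .snd)))) (fun _ => rfl)
    (fun _ _ _ => rfl) Polynomial.X fun a t ht => ?_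
  rw [size_perm (List.perm_insertionSort _ _), Polynomial.eval_X]
  exact (size_le_of_sublist ht.sublist).trans (Nat.le_add_left _ _)

include hle hsum hsame in
theorem polyTime_reduce {l : α → List ι} (hl : PolyTime l) :
    PolyTime fun a => reduce le sumEq same (l a) := by
  have h : PolyTime (reduceSorted le sumEq same) := by
    have hc : PolyTime (changes same) := polyTime_changes hsame .id
    have hp : PolyTime fun l => paths (linked le sumEq (changes same l))
        (isEnd le (changes same l)) l :=
      polyTime_paths (r := fun x : List ι × ι × ι =>
        linked le sumEq (changes same x.1) x.2.1 x.2.2)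
        (e := fun x : List ι × ι => isEnd le (changes same x.1) x.2)
        (polyTime_linked hle hsum (hc.comp .fst) (.comp .fst .snd) (.comp .snd .snd))
        (polyTime_isEnd hle (hc.comp .fst) .snd) .id
    exact polyTime_shortest (.filter (f := fun x : List ι × List ι =>
      headSat (isStart le (changes same x.1)) x.2)
      (polyTime_headSat (r := fun y : (List ι × List ι) × ι => isStart le (changes same y.1.1) y.2)
        (polyTime_isStart hle (hc.comp (.comp .fst .fst)) .snd) .snd) hp)
  exact h.comp (polyTime_insertionSort hle hl)

end NearestNeighbor

open NearestNeighbor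

/-! ### Rational coordinates and labelled points in binary. -/

/-- A rational number `(a - b) / d`, given by the binary words `a`, `b` and `d`. -/
abbrev BinRat : Type := List Bool × List Bool × List Bool

namespace BinRat

open BinWord

/-- The denominator; a denominator `0` is read as `1`. -/
def den (x : BinRat) : List Bool := bif le x.2.2 [] then [true] else x.2.2

/-- Reading a denominator 0 as 1 makes every triple of words a rational number, so `le_iff` and
`value_sum` hold without a condition on well-formedness. -/
theorem val_den_pos (x : BinRat) : 0 < val (den x) := by
  rw [den]
  cases h : le x.2.2 []
  · rw [← Bool.not_eq_true, le_iff] at h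
    simpa [Nat.pos_iff_ne_zero] using h
  · simp

theorem val_den_of_pos {x : BinRat} (h : 0 < val x.2.2) : val (den x) = val x.2.2 := by
  have : le x.2.2 [] = false := by
    rw [← Bool.not_eq_true, le_iff]
    simpa [Nat.pos_iff_ne_zero] using h
  simp [den, this]

/-- The value of the representation. -/
def value (x : BinRat) : ℚ := ((val x.1 : ℚ) - val x.2.1) / val (den x)

/-- Comparison. -/
def le (x y : BinRat) : Bool :=
  BinWord.le (add (mul x.1 (den y)) (mul y.2.1 (den x)))
    (add (mul y.1 (den x)) (mul x.2.1 (den y)))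

/-- Cross-multiplication, with the subtracted parts moved to the other side so that only natural
numbers are computed. -/
theorem le_iff (x y : BinRat) : le x y = true ↔ value x ≤ value y := by
  have hx : (0 : ℚ) < val (den x) := by exact_mod_cast val_den_pos x
  have hy : (0 : ℚ) < val (den y) := by exact_mod_cast val_den_pos y
  rw [le, BinWord.le_iff, value, value, div_le_div_iff₀ hx hy]
  simp only [val_add, val_mul]
  rw [← @Nat.cast_le ℚ]
  push_cast
  constructor <;> intro h <;> linarith

/-- Addition. -/
def sum (x y : BinRat) : BinRat :=
  (add (mul x.1 (den y)) (mul y.1 (den x)), add (mul x.2.1 (den y)) (mul y.2.1 (den x)),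
    mul (den x) (den y))

theorem value_sum (x y : BinRat) : value (sum x y) = value x + value y := by
  have hx : (val (den x) : ℚ) ≠ 0 := by exact_mod_cast (val_den_pos x).ne'
  have hy : (val (den y) : ℚ) ≠ 0 := by exact_mod_cast (val_den_pos y).ne'
  have h : val (den (sum x y)) = val (den x) * val (den y) := by
    rw [val_den_of_pos] <;> simp [sum, val_den_pos]
  rw [value, h, value, value]
  simp only [sum, val_add, val_mul]
  push_cast
  field_simp
  ring

variable {α : Type} [TreeEnc α] {f g : α → BinRat}

theorem polyTime_den (hf : PolyTime f) : PolyTime fun a => den (f a) := by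
  have h : PolyTime fun a => (f a).2.2 := .comp .snd (.comp .snd hf)
  exact .cond (polyTime_le h .nil) (.cons (.const_bool _) .nil) h

theorem polyTime_le (hf : PolyTime f) (hg : PolyTime g) : PolyTime fun a => le (f a) (g a) :=
  BinWord.polyTime_le
    (polyTime_add (polyTime_mul (.comp .fst hf) (polyTime_den hg))
      (polyTime_mul (.comp .fst (.comp .snd hg)) (polyTime_den hf)))
    (polyTime_add (polyTime_mul (.comp .fst hg) (polyTime_den hf))
      (polyTime_mul (.comp .fst (.comp .snd hf)) (polyTime_den hg)))

theorem polyTime_sum (hf : PolyTime f) (hg : PolyTime g) : PolyTime fun a => sum (f a) (g a) :=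
  .pair (polyTime_add (polyTime_mul (.comp .fst hf) (polyTime_den hg))
      (polyTime_mul (.comp .fst hg) (polyTime_den hf)))
    (.pair (polyTime_add (polyTime_mul (.comp .fst (.comp .snd hf)) (polyTime_den hg))
      (polyTime_mul (.comp .fst (.comp .snd hg)) (polyTime_den hf)))
      (polyTime_mul (polyTime_den hf) (polyTime_den hg)))

end BinRat

/-- A labelled point of the line: its encoding, its coordinate, and its label. -/
abbrev LinePoint : Type := List EncSym × BinRat × List Bool

namespace LinePoint

/-- Comparison of the coordinates. -/
def le (p q : LinePoint) : Bool := BinRat.le p.2.1 q.2.1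

/-- Two pairs of points have the same midpoint. -/
def sumEq (s t : LinePoint × LinePoint) : Bool :=
  BinRat.le (BinRat.sum s.1.2.1 s.2.2.1) (BinRat.sum t.1.2.1 t.2.2.1) &&
    BinRat.le (BinRat.sum t.1.2.1 t.2.2.1) (BinRat.sum s.1.2.1 s.2.2.1)

/-- Two points have the same label. -/
def same (p q : LinePoint) : Bool := BinWord.eq p.2.2 q.2.2

/-- The coordinate. -/
def coord (p : LinePoint) : ℚ := p.2.1.value

/-- The label. -/
def label (p : LinePoint) : ℕ := BinWord.val p.2.2

theorem le_iff (p q : LinePoint) : le p q = true ↔ (coord p : ℝ) ≤ coord q := by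
  rw [le, BinRat.le_iff, Rat.cast_le]; rfl

theorem sumEq_iff (s t : LinePoint × LinePoint) : sumEq s t = true ↔
    (coord s.1 : ℝ) + coord s.2 = coord t.1 + coord t.2 := by
  rw [sumEq, Bool.and_eq_true, BinRat.le_iff, BinRat.le_iff, ← le_antisymm_iff,
    BinRat.value_sum, BinRat.value_sum]
  exact_mod_cast Iff.rfl

theorem same_iff (p q : LinePoint) : same p q = true ↔ label p = label q := BinWord.eq_iff _ _

variable {α : Type} [TreeEnc α]

theorem polyTime_reduce {l : α → List LinePoint} (hl : PolyTime l) :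
    PolyTime fun a => reduce le sumEq same (l a) := by
  refine NearestNeighbor.polyTime_reduce ?_ ?_ ?_ hl
  · exact BinRat.polyTime_le (.comp .fst (.comp .snd .fst)) (.comp .fst (.comp .snd .snd))
  · have h₁ : PolyTime fun x : (LinePoint × LinePoint) × LinePoint × LinePoint =>
        BinRat.sum x.1.1.2.1 x.1.2.2.1 :=
      BinRat.polyTime_sum (.comp .fst (.comp .snd (.comp .fst .fst)))
        (.comp .fst (.comp .snd (.comp .snd .fst)))
    have h₂ : PolyTime fun x : (LinePoint × LinePoint) × LinePoint × LinePoint =>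
        BinRat.sum x.2.1.2.1 x.2.2.2.1 :=
      BinRat.polyTime_sum (.comp .fst (.comp .snd (.comp .fst .snd)))
        (.comp .fst (.comp .snd (.comp .snd .snd)))
    exact (BinRat.polyTime_le h₁ h₂).and (BinRat.polyTime_le h₂ h₁)
  · exact BinWord.polyTime_eq (.comp .snd (.comp .snd .fst)) (.comp .snd (.comp .snd .snd))

end LinePoint

/-! ### Parsing of the encodings. -/

namespace EncSym

/-- The maximal subwords without the symbol `s`. -/
def split (s : EncSym) : List EncSym → List (List EncSym)
  | [] => [[]]
  | c :: w => bif decide (c = s) then [] :: split s w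
      else (c :: (split s w).headD []) :: (split s w).tail

theorem split_append {s : EncSym} : ∀ {w : List EncSym} (v : List EncSym), s ∉ w →
    split s (w ++ s :: v) = w :: split s v
  | [], v, _ => by simp [split]
  | c :: w, v, h => by
    simp only [List.mem_cons, not_or] at h
    simp [split, split_append v h.2, Ne.symm h.1]

theorem split_of_notMem {s : EncSym} : ∀ {w : List EncSym}, s ∉ w → split s w = [w]
  | [], _ => rfl
  | c :: w, h => by
    simp only [List.mem_cons, not_or] at h
    simp [split, split_of_notMem h.2, Ne.symm h.1]

theorem size_split (s : EncSym) (w : List EncSym) :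
    split s w ≠ [] ∧ size (split s w) ≤ size w + 2 := by
  induction w with
  | nil => simp [split]
  | cons c w ih =>
    rw [split]
    generalize split s w = l at ih
    cases l with
    | nil => simp at ih
    | cons x l => cases decide (c = s) <;> simp at ih ⊢ <;> omega

variable {α : Type} [TreeEnc α]

theorem polyTime_split (s : EncSym) {w : α → List EncSym} (hw : PolyTime w) :
    PolyTime fun a => split s (w a) := by
  have h₁ : PolyTime fun z : α × EncSym × List EncSym × List (List EncSym) => z.2.1 :=
    .comp .fst .snd
  have h₂ : PolyTime fun z : α × EncSym × List EncSym × List (List EncSym) => z.2.2.2 :=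
    .comp .snd (.comp .snd .snd)
  refine .listRec (F := fun _ w => split s w) (f := fun _ => [[]])
    (g := fun z => bif decide (z.2.1 = s) then [] :: z.2.2.2
      else (z.2.1 :: z.2.2.2.headD []) :: z.2.2.2.tail) hw (.cons .nil .nil)
    (.cond ((PolyTime.sym_to_bool fun c => decide (c = s)).comp h₁) (.cons .nil h₂)
      (.cons (.cons h₁ (.headD h₂ .nil)) (.tail h₂))) (fun _ => rfl) (fun _ _ _ => rfl)
    (Polynomial.X + 2) fun a t ht => ?_
  have h₃ := (size_split s t).2
  have h₄ := size_le_of_sublist ht.sublist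
  simp
  omega

/-- The symbol is a digit. -/
def isBit : EncSym → Bool
  | bit _ => true
  | _ => false

/-- The value of a digit. -/
def bitVal : EncSym → Bool
  | bit b => b
  | _ => false

/-- The digits in a word. -/
def bits (w : List EncSym) : List Bool := w.flatMap fun s => bif isBit s then [bitVal s] else []

theorem bits_encNat (n : ℕ) : bits (encNat n) = Computability.encodeNat n := by
  rw [encNat, bits]
  induction Computability.encodeNat n with
  | nil => rfl
  | cons b l ih => exact congrArg (List.cons b) ih

theorem polyTime_bits {w : α → List EncSym} (hw : PolyTime w) : PolyTime fun a => bits (w a) :=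
  .flatMap (f := fun x : α × EncSym => bif isBit x.2 then [bitVal x.2] else [])
    (.cond (.comp (.sym_to_bool isBit) .snd) (.cons (.comp (.sym_to_bool bitVal) .snd) .nil) .nil) hw

/-- The word starts with a minus sign. -/
def isNeg (w : List EncSym) : Bool := decide (w.headD slash = minus)

theorem polyTime_isNeg {w : α → List EncSym} (hw : PolyTime w) : PolyTime fun a => isNeg (w a) :=
  (PolyTime.sym_to_bool fun c => decide (c = minus)).comp (.headD hw (.const_encSym slash))

/-- The part of a word before the first occurrence of a symbol. -/
def before (s : EncSym) (w : List EncSym) : List EncSym := (split s w).headD []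

/-- The part of a word between the first two occurrences of a symbol. -/
def after (s : EncSym) (w : List EncSym) : List EncSym := (split s w).tail.headD []

theorem polyTime_before (s : EncSym) {w : α → List EncSym} (hw : PolyTime w) :
    PolyTime fun a => before s (w a) := .headD (polyTime_split s hw) .nil

theorem polyTime_after (s : EncSym) {w : α → List EncSym} (hw : PolyTime w) :
    PolyTime fun a => after s (w a) := .headD (.tail (polyTime_split s hw)) .nil

/-- Read a rational number. -/
def readRat (w : List EncSym) : BinRat :=
  (bif isNeg w then [] else bits (before slash w), bif isNeg w then bits (before slash w) else [],
    bits (after slash w))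

/-- Read a labelled point of the line. -/
def readPoint (w : List EncSym) : LinePoint :=
  (before colon w ++ [semicolon], readRat (before colon w), bits (after colon w))

/-- Read a list of labelled points of the line. -/
def readPoints (w : List EncSym) : List LinePoint :=
  (split semicolon w).reverse.tail.reverse.map readPoint

theorem polyTime_readRat {w : α → List EncSym} (hw : PolyTime w) :
    PolyTime fun a => readRat (w a) := by
  have h₁ := polyTime_bits (polyTime_before slash hw)
  have h₂ := polyTime_isNeg hw
  exact .pair (.cond h₂ .nil h₁) (.pair (.cond h₂ h₁ .nil) (polyTime_bits (polyTime_after slash hw)))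

theorem polyTime_readPoint {w : α → List EncSym} (hw : PolyTime w) :
    PolyTime fun a => readPoint (w a) := by
  have h := polyTime_before colon hw
  exact .pair (.append h (.cons (.const_encSym semicolon) .nil))
    (.pair (polyTime_readRat h) (polyTime_bits (polyTime_after colon hw)))

theorem polyTime_readPoints {w : α → List EncSym} (hw : PolyTime w) :
    PolyTime fun a => readPoints (w a) :=
  .map (f := fun x : α × List EncSym => readPoint x.2) (polyTime_readPoint .snd)
    (.reverse (.tail (.reverse (polyTime_split semicolon hw))))

theorem notMem_encNat {s : EncSym} (hs : isBit s = false) (n : ℕ) : s ∉ encNat n := by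
  intro h
  obtain ⟨b, -, rfl⟩ := List.mem_map.1 h
  simp [isBit] at hs

theorem notMem_encInt {s : EncSym} (hs : isBit s = false) (hs' : s ≠ minus) (z : ℤ) :
    s ∉ encInt z := by
  have := notMem_encNat hs z.natAbs
  rw [encInt]
  split_ifs <;> simp [hs', this]

theorem encPoint_eq (x : Fin 1 → ℚ) :
    encPoint x = encInt (x 0).num ++ slash :: (encNat (x 0).den ++ [comma]) := by
  simp [encPoint, encRat]

theorem val_encodeNat (n : ℕ) : BinWord.val (Computability.encodeNat n) = n := by
  have h : ∀ p : PosNum, BinWord.val (Computability.encodePosNum p) = (p : ℕ) := by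
    intro p
    induction p with
    | one => rfl
    | bit1 p ih => simp [Computability.encodePosNum, ih]; ring
    | bit0 p ih => simp [Computability.encodePosNum, ih]; ring
  have h' : ∀ m : Num, BinWord.val (Computability.encodeNum m) = (m : ℕ) := by
    intro m
    cases m with
    | zero => rfl
    | pos p => exact h p
  rw [Computability.encodeNat, h', Num.to_of_nat]

theorem isNeg_encInt (z : ℤ) (w : List EncSym) : isNeg (encInt z ++ slash :: w) = decide (z < 0) := by
  rw [encInt]
  split_ifs with h
  · simp [isNeg, h]
  · rw [encNat]
    -- For `z = 0` there are no digits and the word begins with `slash`, which is not a minus sign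
    -- either.
    cases Computability.encodeNat z.natAbs <;> simp [isNeg, not_lt.1 h]

theorem bits_encInt (z : ℤ) : bits (encInt z) = Computability.encodeNat z.natAbs := by
  rw [← bits_encNat, encInt]
  split_ifs <;> simp [bits, isBit]

theorem before_append {s : EncSym} {w : List EncSym} (v : List EncSym) (h : s ∉ w) :
    before s (w ++ s :: v) = w := by simp [before, split_append v h]

theorem after_append {s : EncSym} {w v : List EncSym} (h : s ∉ w) (h' : s ∉ v) :
    after s (w ++ s :: v) = v := by simp [after, split_append v h, split_of_notMem h']

theorem bits_append (w v : List EncSym) : bits (w ++ v) = bits w ++ bits v := by simp [bits]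

/-- `bits` skips the minus sign before the numerator and the comma after the denominator, so neither
has to be cut off; `isNeg` decides which of the two parts of the difference receives the numerator.
-/
theorem readRat_encPoint (x : Fin 1 → ℚ) : (readRat (encPoint x)).value = x 0 := by
  have h₁ : slash ∉ encInt (x 0).num := notMem_encInt rfl (by simp) _
  have h₂ : slash ∉ encNat (x 0).den ++ [comma] := by
    simp [notMem_encNat (s := slash) rfl]
  have h₃ : bits (encNat (x 0).den ++ [comma]) = Computability.encodeNat (x 0).den := by
    rw [bits_append, bits_encNat]; simp [bits, isBit]
  have h₄ := (x 0).num_div_den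
  have h₅ : BinWord.val (BinRat.den (readRat (encPoint x))) = (x 0).den := by
    rw [BinRat.val_den_of_pos] <;>
      rw [readRat, encPoint_eq, after_append h₁ h₂, h₃, val_encodeNat]
    exact (x 0).den_pos
  rw [BinRat.value, h₅, readRat, encPoint_eq, isNeg_encInt, before_append _ h₁, bits_encInt]
  refine Eq.trans ?_ h₄
  congr 1
  by_cases h : (x 0).num < 0
  · simp only [h, decide_true, cond_true, BinWord.val_nil, val_encodeNat]
    rw [Nat.cast_natAbs, abs_of_neg h]
    push_cast
    ring
  · simp only [h, decide_false, cond_false, BinWord.val_nil, val_encodeNat]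
    rw [Nat.cast_natAbs, abs_of_nonneg (not_lt.1 h)]
    push_cast
    ring

/-- The record of a labelled point. -/
theorem readPoint_eq (x : Fin 1 → ℚ) (n : ℕ) :
    readPoint (encPoint x ++ [colon] ++ encNat n) =
      (encPoint x ++ [semicolon], readRat (encPoint x), Computability.encodeNat n) := by
  have h : colon ∉ encPoint x := by
    rw [encPoint_eq]
    simp [notMem_encNat (s := colon) rfl, notMem_encInt (s := colon) rfl]
  rw [List.append_assoc, List.singleton_append, readPoint, before_append _ h,
    after_append h (notMem_encNat rfl n), bits_encNat]

/-- The symbol `s` terminates the pieces rather than separating them, which leaves an empty last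
piece. `readPoints` removes it by `reverse.tail.reverse`. -/
theorem split_flatMap {ι : Type} (s : EncSym) (w : ι → List EncSym) (l : List ι)
    (h : ∀ a ∈ l, s ∉ w a) : split s (l.flatMap fun a => w a ++ [s]) = l.map w ++ [[]] := by
  induction l with
  | nil => rfl
  | cons a l ih =>
    rw [List.flatMap_cons, List.append_assoc, List.singleton_append, split_append _ (h a (by simp)),
      ih fun b hb => h b (by simp [hb])]
    rfl

end EncSym

/-! ### Correspondence between labelled point sets and lists of records. -/

namespace RatLabelledPointSet

open EncSym

/-- The record of a point of a labelled point set on the line. -/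
def record (L : RatLabelledPointSet 1) (x : {x // x ∈ L.pts}) : LinePoint :=
  (encPoint x.1 ++ [semicolon], readRat (encPoint x.1), Computability.encodeNat (L.c x).1)

/-- The records of the points of a labelled point set on the line. -/
def records (L : RatLabelledPointSet 1) : List LinePoint := L.pts.attach.map L.record

/-- The encoding of the points with their labels. -/
def encRecords (L : RatLabelledPointSet 1) : List EncSym :=
  L.pts.attach.flatMap fun x => encPoint x.1 ++ [colon] ++ encNat (L.c x).1 ++ [semicolon]

theorem readPoints_encRecords (L : RatLabelledPointSet 1) :
    readPoints L.encRecords = L.records := by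
  rw [readPoints, encRecords, split_flatMap]
  · simp only [List.reverse_append, List.reverse_cons, List.reverse_nil, List.nil_append,
      List.singleton_append, List.tail_cons, List.reverse_reverse, List.map_map, records]
    exact List.map_congr_left fun x _ => readPoint_eq _ _
  · intro x _
    simp [encPoint_eq, notMem_encNat (s := semicolon) rfl, notMem_encInt (s := semicolon) rfl]

theorem bar_notMem_encRecords (L : RatLabelledPointSet 1) : bar ∉ L.encRecords := by
  simp [encRecords, encPoint_eq, notMem_encNat (s := bar) rfl, notMem_encInt (s := bar) rfl]

theorem after_encLabelledPointSet (L : RatLabelledPointSet 1) :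
    after bar (encLabelledPointSet L) = L.encRecords := by
  rw [encLabelledPointSet, List.append_assoc, List.singleton_append]
  exact after_append (notMem_encNat rfl _) L.bar_notMem_encRecords

theorem split_encInstance (L : RatLabelledPointSet 1) (k : ℕ) :
    split bar (encInstance (L, k)) = [encNat k, encNat L.m, L.encRecords] := by
  rw [encInstance, encLabelledPointSet, List.append_assoc, List.singleton_append,
    split_append _ (notMem_encNat rfl _), List.append_assoc, List.singleton_append,
    split_append _ (notMem_encNat rfl _)]
  rw [← split_of_notMem L.bar_notMem_encRecords]
  rfl

/-- The coordinate vector of a record. -/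
def toPoint (p : LinePoint) : Fin 1 → ℚ := fun _ => p.coord

theorem toPoint_record (L : RatLabelledPointSet 1) (x : {x // x ∈ L.pts}) :
    toPoint (L.record x) = x.1 := by
  funext i
  rw [Subsingleton.elim i 0]
  exact readRat_encPoint x.1

theorem label_record (L : RatLabelledPointSet 1) (x : {x // x ∈ L.pts}) :
    (L.record x).label = (L.c x).1 := val_encodeNat _

/-- The coordinate of a record as a real number. -/
noncomputable def position (p : LinePoint) : ℝ := p.coord

theorem dist_toPoint (q : EuclideanSpace ℝ (Fin 1)) (p : LinePoint) :
    dist q (ratPoint (toPoint p)) = |q 0 - position p| := by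
  rw [EuclideanSpace.dist_eq, Fin.sum_univ_one, Real.sqrt_sq_eq_abs, Real.dist_eq, abs_abs]
  rfl

theorem mem_pointSet_map {s : List LinePoint} {p : EuclideanSpace ℝ (Fin 1)} :
    p ∈ pointSet (s.map toPoint) ↔ ∃ r ∈ s, ratPoint (toPoint r) = p := by
  simp [pointSet]

variable (L : RatLabelledPointSet 1)

theorem map_toPoint_records : L.records.map toPoint = L.pts := by
  rw [records, List.map_map]
  conv_rhs => rw [← L.pts.attach_map_subtype_val]
  exact List.map_congr_left fun x _ => L.toPoint_record x

theorem nodup_map_toPoint {s : List LinePoint} (hs : s ⊆ L.records) (hn : s.Nodup) :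
    (s.map toPoint).Nodup := by
  refine hn.map_on fun p hp q hq h => ?_
  obtain ⟨x, -, rfl⟩ := List.mem_map.1 (hs hp)
  obtain ⟨y, -, rfl⟩ := List.mem_map.1 (hs hq)
  rw [L.toPoint_record, L.toPoint_record] at h
  rw [Subtype.ext h]

theorem pairwise_position : L.records.Pairwise fun a b => position a ≠ position b := by
  have h : (L.records.map toPoint).Pairwise fun a b => a ≠ b := by
    rw [map_toPoint_records]; exact L.nodup
  rw [List.pairwise_map] at h
  refine h.imp fun h e => h ?_
  funext i
  exact Rat.cast_injective e

theorem pointSet_subset {s : List LinePoint} (hs : s ⊆ L.records) :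
    pointSet (s.map toPoint) ⊆ L.toLabelledPointSet.P := by
  intro p hp
  obtain ⟨r, hr, rfl⟩ := mem_pointSet_map.1 hp
  have : toPoint r ∈ L.pts := by
    rw [← map_toPoint_records]; exact List.mem_map_of_mem (hs hr)
  simpa [toLabelledPointSet, pointSet] using this

theorem near_iff {s : List LinePoint} (q : EuclideanSpace ℝ (Fin 1)) {r : LinePoint}
    (hr : r ∈ s) : Near position s (q 0) r ↔
      ratPoint (toPoint r) ∈ LabelledPointSet.nn q (pointSet (s.map toPoint)) := by
  simp only [Near, LabelledPointSet.nn, Set.mem_ofPred_eq, hr, true_and]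
  constructor
  · refine fun h => ⟨mem_pointSet_map.2 ⟨r, hr, rfl⟩, fun p hp => ?_⟩
    obtain ⟨t, ht, rfl⟩ := mem_pointSet_map.1 hp
    rw [dist_toPoint, dist_toPoint]
    exact h t ht
  · intro h t ht
    have := h.2 _ (mem_pointSet_map.2 ⟨t, ht, rfl⟩)
    rwa [dist_toPoint, dist_toPoint] at this

/-- Labels are compared as natural numbers, the form in which the algorithm sees them. `Q` is a
variable with an equation so that the statement applies to the whole set `P` as well, where the
equality is not definitional. -/
theorem exists_near_iff {s : List LinePoint} (hs : s ⊆ L.records)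
    {Q : Finset (EuclideanSpace ℝ (Fin 1))} (hQ : Q ⊆ L.toLabelledPointSet.P)
    (hQs : Q = pointSet (s.map toPoint)) (q : EuclideanSpace ℝ (Fin 1)) (n : ℕ) :
    (∃ r, Near position s (q 0) r ∧ r.label = n) ↔
      ∃ l ∈ (L.toLabelledPointSet.restrict Q hQ).classification q, l.1 = n := by
  have key : ∀ (x : {x // x ∈ L.pts}) (hx : ratPoint x.1 ∈ L.toLabelledPointSet.P),
      (L.toLabelledPointSet.c ⟨ratPoint x.1, hx⟩).1 = (L.record x).label := by
    intro x hx
    rw [toLabelledPointSet_c, label_record]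
  subst hQs
  constructor
  · rintro ⟨r, hr, rfl⟩
    obtain ⟨x, -, rfl⟩ := List.mem_map.1 (hs hr.1)
    have hmem := (near_iff q hr.1).1 hr
    rw [L.toPoint_record] at hmem
    exact ⟨_, ⟨⟨ratPoint x.1, hmem.1⟩, hmem, rfl⟩, key x _⟩
  · rintro ⟨_, ⟨⟨p, hp⟩, hmem, rfl⟩, rfl⟩
    obtain ⟨r, hr, rfl⟩ := mem_pointSet_map.1 hp
    obtain ⟨x, -, rfl⟩ := List.mem_map.1 (hs hr)
    refine ⟨_, (near_iff q hr).2 hmem, ?_⟩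
    rw [← key x (by rw [← L.toPoint_record]; exact hQ hp)]
    simp only [LabelledPointSet.restrict, L.toPoint_record]

theorem isReducedTrainingSet_iff {s : List LinePoint} (hs : s ⊆ L.records) :
    L.toLabelledPointSet.IsReducedTrainingSet (pointSet (s.map toPoint)) ↔
      SameClassification position LinePoint.label L.records s := by
  have hP : L.toLabelledPointSet.P = pointSet (L.records.map toPoint) := by
    rw [map_toPoint_records]; rfl
  have h₁ := L.exists_near_iff hs (L.pointSet_subset hs) rfl
  have h₂ := L.exists_near_iff (List.Subset.refl _) (Finset.Subset.refl _) hP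
  have e : L.toLabelledPointSet.restrict _ (Finset.Subset.refl _) = L.toLabelledPointSet := rfl
  rw [e] at h₂
  constructor
  · rintro ⟨hQ, h⟩ x n
    have hx : x = (WithLp.toLp 2 fun _ => x : EuclideanSpace ℝ (Fin 1)) 0 := rfl
    rw [hx, h₁, h₂]
    exact exists_congr fun l => and_congr_left fun _ => by
      rw [← h]
      exact Iff.rfl
  · intro h
    refine ⟨L.pointSet_subset hs, ?_⟩
    funext q
    ext l
    have h₃ := h (q 0) l.1
    rw [h₁, h₂] at h₃
    constructor
    · intro hl
      obtain ⟨l', hl', e⟩ := h₃.1 ⟨l, hl, rfl⟩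
      rwa [← Fin.ext e]
    · intro hl
      obtain ⟨l', hl', e⟩ := h₃.2 ⟨l, hl, rfl⟩
      rwa [← Fin.ext (a := l') (b := l) e]

/-- A reduced training set of minimum cardinality. -/
def minimumRecords : List LinePoint :=
  reduce LinePoint.le LinePoint.sumEq LinePoint.same L.records

theorem card_pointSet {s : List LinePoint} (hs : s ⊆ L.records) (hn : s.Nodup) :
    (pointSet (s.map toPoint)).card = s.length := by
  rw [pointSet, Finset.card_map, List.toFinset_card_of_nodup (L.nodup_map_toPoint hs hn),
    List.length_map]

theorem exists_records_of_isReducedTrainingSet {Q : Finset (EuclideanSpace ℝ (Fin 1))}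
    (hQ : L.toLabelledPointSet.IsReducedTrainingSet Q) :
    ∃ s : List LinePoint, s ⊆ L.records ∧ s.Nodup ∧ pointSet (s.map toPoint) = Q := by
  classical
  obtain ⟨hQP, -⟩ := hQ
  refine ⟨L.records.filter fun r => decide (ratPoint (toPoint r) ∈ Q), List.filter_sublist.subset,
    .filter _ (L.pairwise_position.imp fun h => ne_of_apply_ne position h), ?_⟩
  ext p
  rw [mem_pointSet_map]
  constructor
  · rintro ⟨r, hr, rfl⟩
    simpa using (List.mem_filter.1 hr).2
  · intro hp
    obtain ⟨x, rfl⟩ := exists_of_mem_pointSet (hQP hp)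
    refine ⟨L.record x, List.mem_filter.2 ⟨List.mem_map_of_mem (List.mem_attach _ _), ?_⟩, ?_⟩
    · rw [L.toPoint_record]; simpa using hp
    · rw [L.toPoint_record]

theorem minimumRecords_spec : L.minimumRecords.Nodup ∧ L.minimumRecords ⊆ L.records ∧
    L.toLabelledPointSet.IsMinimumReducedTrainingSet (pointSet (L.minimumRecords.map toPoint)) := by
  -- `reduce_spec` needs a point; without points the empty set is the only candidate.
  by_cases hne : L.records = []
  · have h : L.minimumRecords = [] := by rw [minimumRecords, hne]; rfl
    rw [h]
    refine ⟨List.nodup_nil, List.nil_subset _, (L.isReducedTrainingSet_iff (List.nil_subset _)).2 ?_,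
      fun Q _ => by simp [pointSet]⟩
    rw [hne]
    exact fun _ _ => Iff.rfl
  · obtain ⟨h₁, h₂, h₃, h₄⟩ := reduce_spec LinePoint.le_iff LinePoint.sumEq_iff LinePoint.same_iff
      L.pairwise_position hne
    refine ⟨h₁, h₂, (L.isReducedTrainingSet_iff h₂).2 h₃, fun Q hQ => ?_⟩
    obtain ⟨s, hs, hn, rfl⟩ := L.exists_records_of_isReducedTrainingSet hQ
    rw [L.card_pointSet hs hn]
    refine (L.card_pointSet h₂ h₁).trans_le ?_
    exact h₄ s hn hs ((L.isReducedTrainingSet_iff hs).1 hQ)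

/-- Records carry the encoding of their point, so the output is copied from the input and no
rational number has to be written in lowest terms. -/
theorem encPoints_minimumRecords :
    L.minimumRecords.flatMap (fun r => r.1) = encPoints (L.minimumRecords.map toPoint) := by
  rw [encPoints, List.flatMap_map]
  refine List.flatMap_congr fun r hr => ?_
  obtain ⟨x, -, rfl⟩ := List.mem_map.1 (L.minimumRecords_spec.2.1 hr)
  rw [L.toPoint_record]
  rfl

end RatLabelledPointSet

/-! ### Binary lengths and the main theorem. -/

/-- The length of a list in binary. -/
def BinWord.length {ι : Type} : List ι → List Bool
  | [] => []
  | _ :: l => BinWord.inc (length l)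

theorem BinWord.val_length {ι : Type} (l : List ι) : BinWord.val (BinWord.length l) = l.length := by
  induction l with
  | nil => rfl
  | cons a l ih => simp [BinWord.length, ih]

theorem BinWord.polyTime_length {α ι : Type} [TreeEnc α] [TreeEnc ι] {l : α → List ι}
    (hl : PolyTime l) : PolyTime fun a => BinWord.length (l a) := by
  refine .listRec (F := fun _ l => BinWord.length l) (g := fun x => BinWord.inc x.2.2.2) hl .nil
    (BinWord.polyTime_inc (.comp .snd (.comp .snd .snd))) (fun _ => rfl) (fun _ _ _ => rfl)
    (2 * Polynomial.X + 1) fun a t ht => ?_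
  -- One digit per increment is a crude bound, but a linear one is enough.
  have h₁ : ∀ t : List ι, (BinWord.length t).length ≤ t.length := by
    intro t
    induction t with
    | nil => rfl
    | cons a t ih =>
      exact (BinWord.length_inc_le _).trans (Nat.succ_le_succ ih)
  have h₂ := h₁ t
  have h₃ := ht.length_le
  have h₄ := length_le_size (l a)
  rw [BinWord.size_eq]
  simp
  omega

open RatLabelledPointSet EncSym in
/-- In dimension one, the minimum cardinality reduced training set problem is in `P`, and a
minimum cardinality reduced training set can be found in polynomial time. -/
theorem theorem2 :
    InP EncSym.encInstance (MinReducedTrainingSet 1) ∧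
    ∃ f : RatLabelledPointSet 1 → List (Fin 1 → ℚ),
      (∀ L : RatLabelledPointSet 1, (f L).Nodup ∧
        L.toLabelledPointSet.IsMinimumReducedTrainingSet
          (RatLabelledPointSet.pointSet (f L))) ∧
      PolyTimeComputable EncSym.encLabelledPointSet EncSym.encPoints f := by
  constructor
  · classical
    unfold InP
    have hs : PolyTime (split bar) := polyTime_split bar .id
    -- The pieces of an instance between bars are `k`, the number of labels, which plays no role,
    -- and the points.
    have hr : PolyTime fun w => BinWord.length (reduce LinePoint.le LinePoint.sumEq LinePoint.same
        (readPoints ((split bar w).tail.tail.headD []))) :=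
      BinWord.polyTime_length (LinePoint.polyTime_reduce
        (polyTime_readPoints (.headD (.tail (.tail hs)) .nil)))
    refine (BinWord.polyTime_le hr (polyTime_bits (.headD hs .nil))).polyTimeComputable_bool _ _
      fun ⟨L, k⟩ => ?_
    rw [split_encInstance]
    simp only [List.tail_cons, List.headD_cons, readPoints_encRecords, bits_encNat]
    refine Bool.eq_iff_iff.2 (Iff.trans ?_ decide_eq_true_iff.symm)
    rw [BinWord.le_iff, BinWord.val_length, val_encodeNat]
    obtain ⟨h₁, h₂, h₃, h₄⟩ := L.minimumRecords_spec
    rw [L.card_pointSet h₂ h₁] at h₄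
    constructor
    · exact fun h => ⟨_, h₃, (L.card_pointSet h₂ h₁).trans_le h⟩
    · rintro ⟨Q, hQ, hk⟩
      exact (h₄ Q hQ).trans hk
  · refine ⟨fun L => L.minimumRecords.map toPoint, fun L => ?_, ?_⟩
    · obtain ⟨h₁, h₂, h₃⟩ := L.minimumRecords_spec
      exact ⟨L.nodup_map_toPoint h₂ h₁, h₃⟩
    · have hr : PolyTime fun w => reduce LinePoint.le LinePoint.sumEq LinePoint.same
          (readPoints (after bar w)) :=
        LinePoint.polyTime_reduce (polyTime_readPoints (polyTime_after bar .id))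
      refine (PolyTime.flatMap (f := fun x : List EncSym × LinePoint => x.2.1)
        (.comp .fst .snd) hr).polyTimeComputable_word _ _ _ fun L => ?_
      rw [after_encLabelledPointSet, readPoints_encRecords]
      exact L.encPoints_minimumRecords
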